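/- Let $\Phi=\sum_i\delta_{X_i}$ be a homogeneous Poisson point process on $\mathbb{R}^2$ with intensity $\lambda\in(0,\infty)$ (the base stations, BSs), let $s\ge 1$ be an integer (the skipping period, in time slots), and let $Y_1,Y_2,\dots$ be i.i.d. random vectors in $\mathbb{R}^2$, with $(Y_k)_k$ independent of $\Phi$. A mobile user is located at slot $t\in\{0,1,2,\dots\}$ at $$S(t)=\sum_{k=1}^{n}Y_k+\frac{t-ns}{s}\,Y_{n+1},\qquad ns\le t\le (n+1)s,\ n\in\{0,1,2,\dots\}.$$ At slot $0$ the user is served by the BS nearest to $S(0)=\mathbf 0$. Under periodic handover skipping it keeps its connection except at the slots $s,2s,3s,\dots$; at such a slot $t$, if the serving BS is no longer the nearest one to $S(t)$, the user executes a handover and connects to the BS nearest to $S(t)$. Let $\zeta^{(1)}(0,m)$ be the number of handovers executed from slot $0$ to slot $m$ (inclusive). Then $\mathbb{E}[\zeta^{(1)}(0,m)]<\infty$ for every $m$, the limit $$\mathcal{H}^{(1)}=\lim_{m\to\infty}\frac{\mathbb{E}[\zeta^{(1)}(0,m)]}{m}$$ (the handover rate) exists, and $$\mathcal{H}^{(1)}=\frac1s\biggl[1-2\lambda\int_{[0,\infty)}\int_0^{\pi}\int_0^\infty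 r\,e^{-\lambda\,\eta(r,sv,\phi)}\,\mathrm{d}r\,\mathrm{d}\phi\,\mathrm{d}F_V(v)\biggr],$$ where the triple integral is finite (its integrand is integrable for $\mathrm{d}F_V\otimes\mathrm{d}\phi\otimes\mathrm{d}r$), $F_V$ is the distribution of the speed $V_1=\|Y_1\|/s$, and $$\eta(r,\ell,\phi)=w_{r,\ell,\phi}^2\,\arccos\Bigl(\frac{r\cos\phi-\ell}{w_{r,\ell,\phi}}\Bigr)+r^2(\pi-\phi)+r\ell\sin\phi,\qquad w_{r,\ell,\phi}=\sqrt{r^2+\ell^2-2r\ell\cos\phi},$$ the first term of $\eta$ being $0$ when $w_{r,\ell,\phi}=0$. -/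

import Mathlib

open MeasureTheory ProbabilityTheory Filter Topology

noncomputable section

/-- The Euclidean plane. -/
abbrev Plane : Type := EuclideanSpace ℝ (Fin 2)

/-! ### Poisson point processes -/

/-- The point process `∑ i, δ_{X i}` with points `X 0, X 1, …`, as a random measure. -/
def pointProcess {Ω : Type*} (X : ℕ → Ω → Plane) (ω : Ω) : Measure Plane :=
  Measure.sum fun i => Measure.dirac (X i ω)

/-- `N` is a Poisson random measure with intensity measure `μ` on the probability space `(Ω, P)`:
the mass of a Borel set `A` of finite intensity is Poisson distributed with mean `μ A`, and the
masses of finitely many disjoint Borel sets are independent. -/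
structure IsPoissonProcess {Ω : Type*} [MeasurableSpace Ω] (N : Ω → Measure Plane)
    (μ : Measure Plane) (P : Measure Ω) : Prop where
  hasLaw_count : ∀ A : Set Plane, MeasurableSet A → μ A ≠ ⊤ →
    HasLaw (fun ω => N ω A)
      ((poissonMeasure (μ A).toNNReal).map (fun k : ℕ => (k : ENNReal))) P
  indep_count : ∀ (n : ℕ) (A : Fin n → Set Plane), (∀ j, MeasurableSet (A j)) →
    Pairwise (fun j k => Disjoint (A j) (A k)) →
    iIndepFun (fun j ω => N ω (A j)) P

/-- Homogeneous Poisson point process on the plane with intensity `lam`. -/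
def IsHomogeneousPoisson {Ω : Type*} [MeasurableSpace Ω] (N : Ω → Measure Plane)
    (lam : ℝ) (P : Measure Ω) : Prop :=
  IsPoissonProcess N (ENNReal.ofReal lam • (volume : Measure Plane)) P

/-! ### Motion of the user, serving base station and handovers, for one realization

`x i` are the locations of the base stations, `y k` is the displacement of the user during the
cycle from slot `k * s` to slot `(k + 1) * s`. -/

/-- The location of the user at slot `t`: a random walk observed at the multiples of `s`,
interpolated linearly in between. -/
def location (y : ℕ → Plane) (s t : ℕ) : Plane :=
  (∑ k ∈ Finset.range (t / s), y k) + (((t % s : ℕ) : ℝ) / (s : ℝ)) • y (t / s)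

/-- The base station `i` is the (strictly) nearest one to the location `u`. -/
def IsNearestBS (x : ℕ → Plane) (u : Plane) (i : ℕ) : Prop :=
  ∀ j, j ≠ i → ‖x i - u‖ < ‖x j - u‖

open Classical in
/-- The index of the nearest base station to `u` (and `0` if there is none). -/
def nearestBS (x : ℕ → Plane) (u : Plane) : ℕ :=
  if h : ∃ i, IsNearestBS x u i then h.choose else 0

open Classical in
/-- The index of the base station that serves the user at slot `t` under periodic handover skipping
with skipping period `s`: initially the nearest one; the connection is reexamined at the multiples
of `s` only, where it is replaced by the nearest base station if it is no longer the nearest. -/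
def servingBS (x y : ℕ → Plane) (s : ℕ) : ℕ → ℕ
  | 0 => nearestBS x (location y s 0)
  | t + 1 =>
    if s ∣ t + 1 ∧ ¬ IsNearestBS x (location y s (t + 1)) (servingBS x y s t) then
      nearestBS x (location y s (t + 1))
    else servingBS x y s t

/-- The user executes a handover at slot `t + 1`. -/
def HandoverAtSucc (x y : ℕ → Plane) (s t : ℕ) : Prop :=
  s ∣ t + 1 ∧ ¬ IsNearestBS x (location y s (t + 1)) (servingBS x y s t)

open Classical in
/-- The number of handovers executed from slot `a` to slot `b`, that is, at the slots
`a + 1, …, b`. -/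
def handoverCount (x y : ℕ → Plane) (s a b : ℕ) : ℕ :=
  ((Finset.Ico a b).filter fun t => HandoverAtSucc x y s t).card

/-! ### The area formula -/

/-- `w_{r,ℓ,φ} = √(r² + ℓ² - 2 r ℓ cos φ)`. -/
def wDist (r l φ : ℝ) : ℝ := Real.sqrt (r ^ 2 + l ^ 2 - 2 * r * l * Real.cos φ)

/-- `η(r,ℓ,φ) = w² arccos((r cos φ - ℓ)/w) + r² (π - φ) + r ℓ sin φ`. -/
def eta (r l φ : ℝ) : ℝ :=
  wDist r l φ ^ 2 * Real.arccos ((r * Real.cos φ - l) / wDist r l φ)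
    + r ^ 2 * (Real.pi - φ) + r * l * Real.sin φ

end

/-!
Handovers can occur only at the ends of the cycles. If the user was connected to the base station
nearest to the start `u` of a cycle, then there is no handover at its end `u'` exactly when `u` and
`u'` have a common nearest base station (`handoverAtSucc_iff`). The start of a cycle almost surely
has a nearest base station, so the expected number of handovers in `m` slots is `⌊m / s⌋` times
`1 - κ`, where `κ` is the probability of a common nearest base station. This probability is the same
for all cycles because it depends on `‖u' - u‖` only, and the rate is `(1 - κ) / s`.

To compute `κ` for deterministic `u` and `u'`, consider the distribution `nearestBothLaw` of the
location of the common nearest point. A point at `x` is nearest to both locations exactly when the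
union `discUnion u u' x 0` of the two discs around `u` and `u'` through `x` is otherwise void. By
the void probabilities and the independence of counts in disjoint sets, the mass of a small disc
around `x` is, to first order, `λ exp (-λ |discUnion u u' x 0|)` times its area; the differentiation
theorem for measures turns this into a density (`nearestBothLaw_eq_withDensity`). The area is
`eta`, a sum of two circular caps (`volume_discUnion_eq_eta`), and polar coordinates with respect to
`u' - u` give the double integral `commonNearestProb`. For `u = u'` the density is
`λ exp (-λ π |x - u|²)`, whose integral is `1`: this is the almost sure existence of a nearest
point.

The locations of the user are random but independent of the process. The event that there is a
common nearest point is a countable union of rectangles in the space of pairs of a point measure and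
two locations (`commonNearestSet`), hence measurable there, and Fubini's theorem allows one to
average `commonNearestProb` over the displacement (`measure_exists_isNearestBoth_random`).
-/

/-! ### Counting points of the process -/

lemma pointProcess_apply_eq_encard {Ω : Type*} (X : ℕ → Ω → Plane) (ω : Ω) {A : Set Plane}
    (hA : MeasurableSet A) : pointProcess X ω A = ({i | X i ω ∈ A}.encard : ENNReal) := by
  rw [pointProcess, Measure.sum_apply _ hA, ← ENNReal.tsum_set_one,
    tsum_subtype _ (fun _ => (1 : ENNReal))]
  refine tsum_congr fun i => ?_
  rw [Measure.dirac_apply' _ hA]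
  simp [Set.indicator]

lemma pointProcess_eq_zero_iff {Ω : Type*} (X : ℕ → Ω → Plane) (ω : Ω) {A : Set Plane}
    (hA : MeasurableSet A) : pointProcess X ω A = 0 ↔ ∀ i, X i ω ∉ A := by
  rw [pointProcess_apply_eq_encard X ω hA]
  simp [Set.eq_empty_iff_forall_notMem]

lemma pointProcess_eq_one_iff {Ω : Type*} (X : ℕ → Ω → Plane) (ω : Ω) {A : Set Plane}
    (hA : MeasurableSet A) :
    pointProcess X ω A = 1 ↔ ∃ i, X i ω ∈ A ∧ ∀ j, j ≠ i → X j ω ∉ A := by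
  rw [pointProcess_apply_eq_encard X ω hA]
  have : ({i | X i ω ∈ A}.encard : ENNReal) = 1 ↔ {i | X i ω ∈ A}.encard = 1 := by
    norm_cast
  rw [this, Set.encard_eq_one]
  refine exists_congr fun i => ?_
  simp only [Set.ext_iff, Set.mem_ofPred_eq, Set.mem_singleton_iff]
  constructor
  · intro h
    exact ⟨(h i).2 rfl, fun j hj hjA => hj ((h j).1 hjA)⟩
  · rintro ⟨h1, h2⟩ j
    exact ⟨fun h => by_contra fun hj => h2 j hj h, fun h => h ▸ h1⟩

lemma measurable_pointProcess {Ω : Type*} [MeasurableSpace Ω] {X : ℕ → Ω → Plane}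
    (hX : ∀ i, Measurable (X i)) : Measurable (pointProcess X) := by
  refine Measure.measurable_of_measurable_coe _ fun A hA => ?_
  simp only [pointProcess, Measure.sum_apply _ hA, Measure.dirac_apply' _ hA]
  refine Measurable.tsum fun i => ?_
  exact (measurable_one.indicator hA).comp (hX i)

lemma IsHomogeneousPoisson.measure_count_mem {Ω : Type*} [MeasurableSpace Ω] {P : Measure Ω}
    {lam : ℝ} {N : Ω → Measure Plane} (hN : IsHomogeneousPoisson N lam P)
    {A : Set Plane} (hA : MeasurableSet A) (hfin : volume A ≠ ⊤) {S : Set ENNReal}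
    (hS : MeasurableSet S) :
    P {ω | N ω A ∈ S} =
      poissonMeasure (ENNReal.ofReal lam * volume A).toNNReal {k : ℕ | (k : ENNReal) ∈ S} := by
  have h := hN.hasLaw_count A hA (by
    simpa using ENNReal.mul_ne_top ENNReal.ofReal_ne_top hfin)
  have h2 := congrArg (fun m => m S) h.map_eq
  rw [Measure.map_apply_of_aemeasurable h.aemeasurable hS,
    Measure.map_apply (by fun_prop) hS] at h2
  exact h2

/-- The void probabilities of a homogeneous Poisson process. -/
lemma IsHomogeneousPoisson.measure_count_eq_zero {Ω : Type*} [MeasurableSpace Ω] {P : Measure Ω}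
    {lam : ℝ} (hlam : 0 < lam) {N : Ω → Measure Plane} (hN : IsHomogeneousPoisson N lam P)
    {A : Set Plane} (hA : MeasurableSet A) (hfin : volume A ≠ ⊤) :
    P {ω | N ω A = 0} = ENNReal.ofReal (Real.exp (-(lam * (volume A).toReal))) := by
  have h := hN.measure_count_mem hA hfin (measurableSet_singleton 0)
  have h0 : {k : ℕ | (k : ENNReal) ∈ ({0} : Set ENNReal)} = {0} := by ext; simp
  rw [h0, poissonMeasure_singleton] at h
  refine h.trans ?_
  have : ((ENNReal.ofReal lam * volume A).toNNReal : ℝ) = lam * (volume A).toReal := by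
    rw [ENNReal.coe_toNNReal_eq_toReal, ENNReal.toReal_mul, ENNReal.toReal_ofReal hlam.le]
  rw [this]
  simp

lemma IsHomogeneousPoisson.measure_count_eq_one {Ω : Type*} [MeasurableSpace Ω] {P : Measure Ω}
    {lam : ℝ} (hlam : 0 < lam) {N : Ω → Measure Plane} (hN : IsHomogeneousPoisson N lam P)
    {A : Set Plane} (hA : MeasurableSet A) (hfin : volume A ≠ ⊤) :
    P {ω | N ω A = 1} = ENNReal.ofReal
      (lam * (volume A).toReal * Real.exp (-(lam * (volume A).toReal))) := by
  have h := hN.measure_count_mem hA hfin (measurableSet_singleton 1)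
  have h0 : {k : ℕ | (k : ENNReal) ∈ ({1} : Set ENNReal)} = {1} := by ext; simp
  rw [h0, poissonMeasure_singleton] at h
  refine h.trans ?_
  have : ((ENNReal.ofReal lam * volume A).toNNReal : ℝ) = lam * (volume A).toReal := by
    rw [ENNReal.coe_toNNReal_eq_toReal, ENNReal.toReal_mul, ENNReal.toReal_ofReal hlam.le]
  rw [this]
  simp [mul_comm]

lemma IsHomogeneousPoisson.measure_count_ne_zero_le {Ω : Type*} [MeasurableSpace Ω]
    {P : Measure Ω} {lam : ℝ} (hlam : 0 < lam) {N : Ω → Measure Plane}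
    (hN : IsHomogeneousPoisson N lam P)
    {A : Set Plane} (hA : MeasurableSet A) (hfin : volume A ≠ ⊤) :
    P {ω | N ω A ≠ 0} ≤ ENNReal.ofReal (lam * (volume A).toReal) := by
  have h := hN.measure_count_mem hA hfin (measurableSet_singleton (0 : ENNReal)).compl
  have h0 : {k : ℕ | (k : ENNReal) ∈ ({0}ᶜ : Set ENNReal)} = {0}ᶜ := by ext; simp
  rw [h0, prob_compl_eq_one_sub (measurableSet_singleton 0), poissonMeasure_singleton] at h
  have : ((ENNReal.ofReal lam * volume A).toNNReal : ℝ) = lam * (volume A).toReal := by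
    rw [ENNReal.coe_toNNReal_eq_toReal, ENNReal.toReal_mul, ENNReal.toReal_ofReal hlam.le]
  change P {ω | N ω A ∈ ({0}ᶜ : Set ENNReal)} ≤ _
  rw [h, this, ← ENNReal.ofReal_one, ← ENNReal.ofReal_sub _ (by positivity)]
  refine ENNReal.ofReal_le_ofReal ?_
  have := Real.add_one_le_exp (-(lam * (volume A).toReal))
  simp only [pow_zero, mul_one, Nat.factorial_zero, Nat.cast_one, div_one]
  linarith

lemma IsHomogeneousPoisson.ae_count_lt_top {Ω : Type*} [MeasurableSpace Ω] {P : Measure Ω}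
    {lam : ℝ} {N : Ω → Measure Plane} (hN : IsHomogeneousPoisson N lam P)
    {A : Set Plane} (hA : MeasurableSet A) (hfin : volume A ≠ ⊤) :
    ∀ᵐ ω ∂P, N ω A < ⊤ := by
  have h := hN.measure_count_mem hA hfin (measurableSet_singleton (⊤ : ENNReal))
  have h0 : {k : ℕ | (k : ENNReal) ∈ ({⊤} : Set ENNReal)} = ∅ := by ext; simp
  rw [h0, measure_empty] at h
  rw [ae_iff]
  simpa using h

lemma IsHomogeneousPoisson.measure_inter_of_disjoint {Ω : Type*} [MeasurableSpace Ω]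
    {P : Measure Ω} {lam : ℝ} {N : Ω → Measure Plane} (hN : IsHomogeneousPoisson N lam P)
    {A B : Set Plane} (hA : MeasurableSet A) (hB : MeasurableSet B) (hAB : Disjoint A B)
    {S T : Set ENNReal} (hS : MeasurableSet S) (hT : MeasurableSet T) :
    P ({ω | N ω A ∈ S} ∩ {ω | N ω B ∈ T}) = P {ω | N ω A ∈ S} * P {ω | N ω B ∈ T} := by
  have h := (hN.indep_count 2 ![A, B] (by intro j; fin_cases j <;> simpa) (by
    intro j k hjk
    fin_cases j <;> fin_cases k <;> first | exact absurd rfl hjk | exact hAB | exact hAB.symm)).indepFun (i := 0) (j := 1) (by simp)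
  exact h.measure_inter_preimage_eq_mul S T hS hT

/-! ### The points nearest to two locations -/

/-- The union of the discs around `u` and `u'` whose boundaries pass through `x`, with both radii
enlarged by `ε` (which may be negative). A point of the process at `x` is nearest to both `u`
and `u'` exactly when the region `discUnion u u' x 0` holds no other point. -/
def discUnion (u u' x : Plane) (ε : ℝ) : Set Plane :=
  Metric.closedBall u (dist x u + ε) ∪ Metric.closedBall u' (dist x u' + ε)

lemma measurableSet_discUnion (u u' x : Plane) (ε : ℝ) : MeasurableSet (discUnion u u' x ε) :=
  Metric.isClosed_closedBall.measurableSet.union Metric.isClosed_closedBall.measurableSet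

lemma volume_discUnion_ne_top (u u' x : Plane) (ε : ℝ) : volume (discUnion u u' x ε) ≠ ⊤ :=
  measure_union_ne_top measure_closedBall_lt_top.ne measure_closedBall_lt_top.ne

/-- The area of a slightly enlarged `discUnion` is continuous in the enlargement, because circles
have measure zero; removing a vanishing disc around `x` does not change the limit. -/
lemma tendsto_volume_discUnion_diff (u u' x : Plane) :
    Tendsto (fun ε => volume (discUnion u u' x (-ε) \ Metric.closedBall x ε)) (𝓝 0)
      (𝓝 (volume (discUnion u u' x 0))) := by
  refine tendsto_measure_of_ae_tendsto_indicator (𝓝 0) (measurableSet_discUnion u u' x 0)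
    (fun ε => (measurableSet_discUnion u u' x (-ε)).diff
      Metric.isClosed_closedBall.measurableSet)
    (measurableSet_discUnion u u' x 1) (volume_discUnion_ne_top u u' x 1) ?_ ?_
  · filter_upwards [Ioi_mem_nhds (show (-1 : ℝ) < 0 by norm_num)] with ε hε
    rw [Set.mem_Ioi] at hε
    exact Set.sdiff_subset.trans (Set.union_subset_union
      (Metric.closedBall_subset_closedBall (by linarith))
      (Metric.closedBall_subset_closedBall (by linarith)))
  · have h1 : ∀ᵐ z ∂(volume : Measure Plane), z ∉ Metric.sphere u (dist x u) :=
      measure_eq_zero_iff_ae_notMem.1 (Measure.addHaar_sphere _ _ _)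
    have h2 : ∀ᵐ z ∂(volume : Measure Plane), z ∉ Metric.sphere u' (dist x u') :=
      measure_eq_zero_iff_ae_notMem.1 (Measure.addHaar_sphere _ _ _)
    have h3 : ∀ᵐ z ∂(volume : Measure Plane), z ∉ ({x} : Set Plane) :=
      measure_eq_zero_iff_ae_notMem.1 (measure_singleton _)
    filter_upwards [h1, h2, h3] with z hz1 hz2 hz3
    have key : ∀ v : Plane, z ∉ Metric.sphere v (dist x v) →
        ∀ᶠ ε in 𝓝 (0 : ℝ), (dist z v ≤ dist x v + -ε ↔ dist z v ≤ dist x v) := by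
      intro v hv
      rw [Metric.mem_sphere] at hv
      rcases lt_or_gt_of_ne hv with h | h
      · filter_upwards [Iio_mem_nhds (sub_pos.2 h)] with ε hε
        rw [Set.mem_Iio] at hε
        exact ⟨fun _ => h.le, fun _ => by linarith⟩
      · filter_upwards [Ioi_mem_nhds (sub_neg.2 h)] with ε hε
        rw [Set.mem_Ioi] at hε
        exact ⟨fun _ => by linarith, fun _ => by linarith⟩
    have hzx : 0 < dist z x := dist_pos.2 hz3
    filter_upwards [key u hz1, key u' hz2, Iio_mem_nhds hzx] with ε h1 h2 h3
    simp only [discUnion, Set.mem_sdiff, Set.mem_union, Metric.mem_closedBall, h1, h2, add_zero]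
    rw [Set.mem_Iio] at h3
    simp [h3]

lemma tendsto_volume_discUnion (u u' x : Plane) :
    Tendsto (fun ε => volume (discUnion u u' x ε)) (𝓝[>] 0)
      (𝓝 (volume (discUnion u u' x 0))) := by
  have h := tendsto_measure_biInter_gt (μ := (volume : Measure Plane))
    (s := fun ε => discUnion u u' x ε) (a := 0)
    (fun r _ => (measurableSet_discUnion u u' x r).nullMeasurableSet)
    (fun i j _ hij => Set.union_subset_union
      (Metric.closedBall_subset_closedBall (by linarith))
      (Metric.closedBall_subset_closedBall (by linarith)))
    ⟨1, one_pos, volume_discUnion_ne_top u u' x 1⟩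
  have h2 : (⋂ r : ℝ, ⋂ (_ : r > 0), discUnion u u' x r) = discUnion u u' x 0 := by
    ext z
    simp only [Set.mem_iInter, discUnion, Set.mem_union, Metric.mem_closedBall, add_zero]
    constructor
    · intro hz
      by_contra! hc
      have h1 : 0 < min (dist z u - dist x u) (dist z u' - dist x u') :=
        lt_min (by linarith) (by linarith)
      rcases hz _ (half_pos h1) with h | h
      · linarith [min_le_left (dist z u - dist x u) (dist z u' - dist x u')]
      · linarith [min_le_right (dist z u - dist x u) (dist z u' - dist x u')]
    · rintro hz r hr
      exact hz.imp (fun h => by linarith) (fun h => by linarith)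
  rw [h2] at h
  exact h

lemma IsNearestBS.unique {x : ℕ → Plane} {u : Plane} {i j : ℕ} (hi : IsNearestBS x u i)
    (hj : IsNearestBS x u j) : i = j := by
  by_contra h
  exact lt_asymm (hi j (Ne.symm h)) (hj i h)

lemma measurableSet_isNearestBS {Ω : Type*} [MeasurableSpace Ω] {X : ℕ → Ω → Plane}
    (hX : ∀ i, Measurable (X i)) {U : Ω → Plane} (hU : Measurable U) (i : ℕ) :
    MeasurableSet {ω | IsNearestBS (fun j => X j ω) (U ω) i} := by
  simp only [IsNearestBS, Set.ofPred_forall]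
  exact MeasurableSet.iInter fun j => MeasurableSet.iInter fun _ =>
    measurableSet_lt ((hX i).sub hU).norm ((hX j).sub hU).norm

/-- The point `x i` is the nearest one to both locations `u` and `u'`. -/
def IsNearestBoth (x : ℕ → Plane) (u u' : Plane) (i : ℕ) : Prop :=
  IsNearestBS x u i ∧ IsNearestBS x u' i

lemma measurableSet_isNearestBoth {Ω : Type*} [MeasurableSpace Ω] {X : ℕ → Ω → Plane}
    (hX : ∀ i, Measurable (X i)) {U U' : Ω → Plane} (hU : Measurable U) (hU' : Measurable U')
    (i : ℕ) : MeasurableSet {ω | IsNearestBoth (fun j => X j ω) (U ω) (U' ω) i} :=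
  (measurableSet_isNearestBS hX hU i).inter (measurableSet_isNearestBS hX hU' i)

/-- The distribution of the location of the point that is nearest to both `u` and `u'`, as a
measure whose total mass is the probability that there is such a point. -/
noncomputable def nearestBothLaw {Ω : Type*} [MeasurableSpace Ω] (P : Measure Ω)
    (X : ℕ → Ω → Plane) (u u' : Plane) : Measure Plane :=
  Measure.sum fun i =>
    (P.restrict {ω | IsNearestBoth (fun j => X j ω) u u' i}).map (X i)

lemma nearestBothLaw_apply {Ω : Type*} [MeasurableSpace Ω] (P : Measure Ω)
    {X : ℕ → Ω → Plane} (hX : ∀ i, Measurable (X i)) (u u' : Plane) {A : Set Plane}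
    (hA : MeasurableSet A) :
    nearestBothLaw P X u u' A =
      P {ω | ∃ i, X i ω ∈ A ∧ IsNearestBoth (fun j => X j ω) u u' i} := by
  rw [Set.ofPred_exists, measure_iUnion, nearestBothLaw, Measure.sum_apply _ hA]
  · refine tsum_congr fun i => ?_
    rw [Measure.map_apply (hX i) hA, Measure.restrict_apply (hX i hA)]
    rfl
  · intro i j hij
    refine Set.disjoint_left.2 fun ω h1 h2 => hij ?_
    exact h1.2.1.unique h2.2.1
  · intro i
    exact (hX i hA).inter
      (measurableSet_isNearestBoth hX measurable_const measurable_const i)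

/-- A closed disc around `x` holds the nearest point to `u` and `u'` as soon as it holds exactly
one point and the enlarged `discUnion` holds no other. -/
lemma le_nearestBothLaw_closedBall {Ω : Type*} [MeasurableSpace Ω] {P : Measure Ω} {lam : ℝ}
    (hlam : 0 < lam) {X : ℕ → Ω → Plane} (hX : ∀ i, Measurable (X i))
    (hP : IsHomogeneousPoisson (pointProcess X) lam P) (u u' x : Plane) {ε : ℝ} :
    ENNReal.ofReal (lam * Real.exp (-(lam * (volume (discUnion u u' x ε)).toReal)))
        * volume (Metric.closedBall x ε) ≤
      nearestBothLaw P X u u' (Metric.closedBall x ε) := by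
  set b := Metric.closedBall x ε
  set W := discUnion u u' x ε
  have hb : MeasurableSet b := Metric.isClosed_closedBall.measurableSet
  have hW : MeasurableSet W := measurableSet_discUnion u u' x ε
  have hbfin : volume b ≠ ⊤ := measure_closedBall_lt_top.ne
  have hWfin : volume W ≠ ⊤ := volume_discUnion_ne_top u u' x ε
  have hball : ∀ z ∈ b, ∀ v, dist z v ≤ dist x v + ε := fun z hz v => by
    have := dist_triangle z x v
    have := Metric.mem_closedBall.1 hz
    linarith
  have hbW : b ⊆ W := fun z hz => Or.inl (hball z hz u)
  have hdiff : volume (W \ b) ≠ ⊤ := measure_ne_top_of_subset Set.sdiff_subset hWfin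
  have hvol : (volume W).toReal = (volume b).toReal + (volume (W \ b)).toReal := by
    rw [← ENNReal.toReal_add hbfin hdiff, measure_add_sdiff hb.nullMeasurableSet,
      Set.union_eq_self_of_subset_left hbW]
  calc _ = P ({ω | pointProcess X ω b ∈ ({1} : Set ENNReal)} ∩
        {ω | pointProcess X ω (W \ b) ∈ ({0} : Set ENNReal)}) := by
        rw [hP.measure_inter_of_disjoint hb (hW.diff hb) Set.disjoint_sdiff_right
          (measurableSet_singleton _) (measurableSet_singleton _)]
        simp only [Set.mem_singleton_iff]
        rw [hP.measure_count_eq_one hlam hb hbfin, hP.measure_count_eq_zero hlam (hW.diff hb) hdiff,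
          ← ENNReal.ofReal_mul (by positivity), ← ENNReal.ofReal_toReal hbfin,
          ← ENNReal.ofReal_mul (by positivity), hvol, mul_add, neg_add, Real.exp_add,
          ENNReal.toReal_ofReal ENNReal.toReal_nonneg]
        congr 1
        ring
    _ ≤ _ := by
        rw [nearestBothLaw_apply P hX u u' hb]
        refine measure_mono fun ω hω => ?_
        obtain ⟨h1, h0⟩ := hω
        obtain ⟨i, hi, hij⟩ := (pointProcess_eq_one_iff X ω hb).1 h1
        have h0 := (pointProcess_eq_zero_iff X ω (hW.diff hb)).1 h0
        have hout : ∀ j, j ≠ i → X j ω ∉ W := fun j hj hjW => h0 j ⟨hjW, hij j hj⟩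
        refine ⟨i, hi, fun j hj => ?_, fun j hj => ?_⟩
        · have : ¬ dist (X j ω) u ≤ dist x u + ε := fun h => hout j hj (Or.inl h)
          rw [not_le] at this
          simpa only [dist_eq_norm] using (hball _ hi u).trans_lt this
        · have : ¬ dist (X j ω) u' ≤ dist x u' + ε := fun h => hout j hj (Or.inr h)
          rw [not_le] at this
          simpa only [dist_eq_norm] using (hball _ hi u').trans_lt this

/-- If a closed disc around `x` holds the nearest point to `u` and `u'`, then it holds a point and
the rest of the shrunken `discUnion` holds none. -/
lemma nearestBothLaw_closedBall_le {Ω : Type*} [MeasurableSpace Ω] {P : Measure Ω} {lam : ℝ}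
    (hlam : 0 < lam) {X : ℕ → Ω → Plane} (hX : ∀ i, Measurable (X i))
    (hP : IsHomogeneousPoisson (pointProcess X) lam P) (u u' x : Plane) {ε : ℝ} :
    nearestBothLaw P X u u' (Metric.closedBall x ε) ≤
      ENNReal.ofReal (lam * Real.exp
        (-(lam * (volume (discUnion u u' x (-ε) \ Metric.closedBall x ε)).toReal)))
        * volume (Metric.closedBall x ε) := by
  set b := Metric.closedBall x ε
  set W := discUnion u u' x (-ε)
  have hb : MeasurableSet b := Metric.isClosed_closedBall.measurableSet
  have hW : MeasurableSet W := measurableSet_discUnion u u' x (-ε)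
  have hbfin : volume b ≠ ⊤ := measure_closedBall_lt_top.ne
  have hWfin : volume W ≠ ⊤ := volume_discUnion_ne_top u u' x (-ε)
  have hball : ∀ z ∈ b, ∀ v, dist x v + -ε ≤ dist z v := fun z hz v => by
    have := dist_triangle x z v
    have := Metric.mem_closedBall'.1 hz
    linarith
  have hdiff : volume (W \ b) ≠ ⊤ := measure_ne_top_of_subset Set.sdiff_subset hWfin
  calc _ ≤ P ({ω | pointProcess X ω b ∈ ({0}ᶜ : Set ENNReal)} ∩
        {ω | pointProcess X ω (W \ b) ∈ ({0} : Set ENNReal)}) := by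
        rw [nearestBothLaw_apply P hX u u' hb]
        refine measure_mono ?_
        rintro ω ⟨i, hi, h1, h2⟩
        refine ⟨fun h => (pointProcess_eq_zero_iff X ω hb).1 h i hi,
          (pointProcess_eq_zero_iff X ω (hW.diff hb)).2 ?_⟩
        rintro j ⟨hjW, hjb⟩
        have hji : j ≠ i := fun h => hjb (h ▸ hi)
        rcases hjW with h | h
        · have h3 := h1 j hji
          rw [← dist_eq_norm, ← dist_eq_norm] at h3
          linarith [Metric.mem_closedBall.1 h, hball _ hi u]
        · have h3 := h2 j hji
          rw [← dist_eq_norm, ← dist_eq_norm] at h3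
          linarith [Metric.mem_closedBall.1 h, hball _ hi u']
    _ ≤ ENNReal.ofReal (lam * (volume b).toReal) *
        ENNReal.ofReal (Real.exp (-(lam * (volume (W \ b)).toReal))) := by
        rw [hP.measure_inter_of_disjoint hb (hW.diff hb) Set.disjoint_sdiff_right
          (measurableSet_singleton _).compl (measurableSet_singleton _)]
        exact mul_le_mul' (hP.measure_count_ne_zero_le hlam hb hbfin)
          (hP.measure_count_eq_zero hlam (hW.diff hb) hdiff).le
    _ = _ := by
        conv_rhs => rw [← ENNReal.ofReal_toReal hbfin]
        rw [← ENNReal.ofReal_mul (by positivity), ← ENNReal.ofReal_mul (by positivity)]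
        congr 1
        ring

lemma nearestBothLaw_absolutelyContinuous {Ω : Type*} [MeasurableSpace Ω] {P : Measure Ω}
    {lam : ℝ} (hlam : 0 < lam) {X : ℕ → Ω → Plane} (hX : ∀ i, Measurable (X i))
    (hP : IsHomogeneousPoisson (pointProcess X) lam P) (u u' : Plane) :
    nearestBothLaw P X u u' ≪ volume := by
  refine Measure.AbsolutelyContinuous.mk fun A hA h0 => ?_
  rw [nearestBothLaw_apply P hX u u' hA]
  refine measure_mono_null (t := {ω | pointProcess X ω A ≠ 0}) ?_ ?_
  · rintro ω ⟨i, hi, -⟩ h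
    exact (pointProcess_eq_zero_iff X ω hA).1 h i hi
  · have := hP.measure_count_ne_zero_le hlam hA (by simp [h0])
    simpa [h0] using this

/-- The location of the point nearest to both `u` and `u'` has a density, obtained by
differentiating its distribution along shrinking discs: the intensity times the probability that
the `discUnion` is void. -/
theorem nearestBothLaw_eq_withDensity {Ω : Type*} [MeasurableSpace Ω] {P : Measure Ω}
    [IsProbabilityMeasure P]
    {lam : ℝ} (hlam : 0 < lam) {X : ℕ → Ω → Plane} (hX : ∀ i, Measurable (X i))
    (hP : IsHomogeneousPoisson (pointProcess X) lam P) (u u' : Plane) :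
    nearestBothLaw P X u u' = volume.withDensity fun x =>
      ENNReal.ofReal (lam * Real.exp (-(lam * (volume (discUnion u u' x 0)).toReal))) := by
  have hfin : IsFiniteMeasure (nearestBothLaw P X u u') := ⟨by
    rw [nearestBothLaw_apply P hX u u' MeasurableSet.univ]
    exact measure_lt_top _ _⟩
  rw [← Measure.withDensity_rnDeriv_eq _ _
    (nearestBothLaw_absolutelyContinuous hlam hX hP u u')]
  refine withDensity_congr_ae ?_
  filter_upwards [Besicovitch.ae_tendsto_rnDeriv (nearestBothLaw P X u u') volume] with x hx
  refine tendsto_nhds_unique hx ?_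
  have hF : ∀ {f : ℝ → ENNReal}, Tendsto f (𝓝[>] 0) (𝓝 (volume (discUnion u u' x 0))) →
      Tendsto (fun ε => ENNReal.ofReal (lam * Real.exp (-(lam * (f ε).toReal)))) (𝓝[>] 0)
        (𝓝 (ENNReal.ofReal (lam * Real.exp (-(lam * (volume (discUnion u u' x 0)).toReal))))) := by
    intro f hf
    have h1 := (ENNReal.tendsto_toReal (volume_discUnion_ne_top u u' x 0)).comp hf
    have h2 : Continuous fun t : ℝ => ENNReal.ofReal (lam * Real.exp (-(lam * t))) :=
      ENNReal.continuous_ofReal.comp (by fun_prop)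
    exact (h2.tendsto _).comp h1
  refine tendsto_of_tendsto_of_tendsto_of_le_of_le' (hF (tendsto_volume_discUnion u u' x))
    (hF ((tendsto_volume_discUnion_diff u u' x).mono_left nhdsWithin_le_nhds)) ?_ ?_
  · filter_upwards [self_mem_nhdsWithin] with ε hε
    rw [ENNReal.le_div_iff_mul_le (Or.inl (Metric.measure_closedBall_pos _ _ hε).ne')
      (Or.inl measure_closedBall_lt_top.ne)]
    exact le_nearestBothLaw_closedBall hlam hX hP u u' x
  · filter_upwards [self_mem_nhdsWithin] with ε hε
    exact ENNReal.div_le_of_le_mul (nearestBothLaw_closedBall_le hlam hX hP u u' x)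

lemma measure_exists_isNearestBoth {Ω : Type*} [MeasurableSpace Ω] {P : Measure Ω}
    [IsProbabilityMeasure P]
    {lam : ℝ} (hlam : 0 < lam) {X : ℕ → Ω → Plane} (hX : ∀ i, Measurable (X i))
    (hP : IsHomogeneousPoisson (pointProcess X) lam P) (u u' : Plane) :
    P {ω | ∃ i, IsNearestBoth (fun j => X j ω) u u' i} = ∫⁻ x,
      ENNReal.ofReal (lam * Real.exp (-(lam * (volume (discUnion u u' x 0)).toReal))) := by
  have h := nearestBothLaw_apply P hX u u' MeasurableSet.univ
  rw [nearestBothLaw_eq_withDensity hlam hX hP, withDensity_apply _ MeasurableSet.univ,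
    Measure.restrict_univ] at h
  simpa using h.symm

/-! ### The area of the union of two discs -/

lemma integral_two_mul_sqrt_sq_sub_sq {R : ℝ} (hR : 0 ≤ R) {θ : ℝ} (h0 : 0 ≤ θ)
    (hθ : θ ≤ Real.pi) :
    ∫ x in (R * Real.cos θ)..R, 2 * √(R ^ 2 - x ^ 2) =
      R ^ 2 * (θ - Real.cos θ * Real.sin θ) := by
  have h := intervalIntegral.integral_comp_mul_deriv (a := θ) (b := 0)
    (f := fun t => R * Real.cos t) (f' := fun t => R * -Real.sin t)
    (g := fun x => 2 * √(R ^ 2 - x ^ 2))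
    (fun t _ => (Real.hasDerivAt_cos t).const_mul R) (by fun_prop) (by fun_prop)
  simp only [Real.cos_zero, mul_one] at h
  rw [← h]
  have h2 : ∫ x in θ..0, ((fun x => 2 * √(R ^ 2 - x ^ 2)) ∘ fun t => R * Real.cos t) x *
      (R * -Real.sin x) = ∫ x in θ..0, (-2 * R ^ 2) * Real.sin x ^ 2 := by
    refine intervalIntegral.integral_congr fun t ht => ?_
    rw [Set.uIcc_of_ge h0] at ht
    have hs : 0 ≤ Real.sin t := Real.sin_nonneg_of_nonneg_of_le_pi ht.1 (ht.2.trans hθ)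
    have : R ^ 2 - (R * Real.cos t) ^ 2 = (R * Real.sin t) ^ 2 := by
      rw [mul_pow, mul_pow, Real.sin_sq]
      ring
    simp only [Function.comp_apply, this, Real.sqrt_sq (mul_nonneg hR hs)]
    ring
  rw [h2, intervalIntegral.integral_const_mul, integral_sin_sq]
  simp
  ring

/-- The area of the circular cap cut off by a vertical chord of half opening angle `θ`. -/
lemma volume_circular_cap {R : ℝ} (hR : 0 ≤ R) {θ : ℝ} (h0 : 0 ≤ θ) (hθ : θ ≤ Real.pi) :
    volume {p : ℝ × ℝ | R * Real.cos θ ≤ p.1 ∧ p.1 ^ 2 + p.2 ^ 2 ≤ R ^ 2} =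
      ENNReal.ofReal (R ^ 2 * (θ - Real.cos θ * Real.sin θ)) := by
  have hm : MeasurableSet {p : ℝ × ℝ | R * Real.cos θ ≤ p.1 ∧ p.1 ^ 2 + p.2 ^ 2 ≤ R ^ 2} := by
    rw [Set.ofPred_and]
    exact (measurableSet_le (by fun_prop) (by fun_prop)).inter
      (measurableSet_le (by fun_prop) (by fun_prop))
  have hle : R * Real.cos θ ≤ R := mul_le_of_le_one_right hR (Real.cos_le_one θ)
  have hge : -R ≤ R * Real.cos θ := by nlinarith [Real.neg_one_le_cos θ]
  rw [Measure.volume_eq_prod, Measure.prod_apply hm]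
  have hsec : ∀ x : ℝ, volume (Prod.mk x ⁻¹'
      {p : ℝ × ℝ | R * Real.cos θ ≤ p.1 ∧ p.1 ^ 2 + p.2 ^ 2 ≤ R ^ 2}) =
      (Set.Icc (R * Real.cos θ) R).indicator
        (fun x => ENNReal.ofReal (2 * √(R ^ 2 - x ^ 2))) x := by
    intro x
    by_cases hx : x ∈ Set.Icc (R * Real.cos θ) R
    · rw [Set.indicator_of_mem hx]
      have hnn : 0 ≤ R ^ 2 - x ^ 2 := by nlinarith [hx.1, hx.2]
      have : Prod.mk x ⁻¹' {p : ℝ × ℝ | R * Real.cos θ ≤ p.1 ∧ p.1 ^ 2 + p.2 ^ 2 ≤ R ^ 2} =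
          Set.Icc (-√(R ^ 2 - x ^ 2)) (√(R ^ 2 - x ^ 2)) := by
        ext y
        simp only [Set.mem_preimage, Set.mem_ofPred_eq, Set.mem_Icc, hx.1, true_and]
        rw [← abs_le, ← Real.sqrt_sq_eq_abs, Real.sqrt_le_sqrt_iff hnn]
        constructor <;> intro h <;> linarith
      rw [this, Real.volume_Icc]
      congr 1
      ring
    · rw [Set.indicator_of_notMem hx]
      have : Prod.mk x ⁻¹' {p : ℝ × ℝ | R * Real.cos θ ≤ p.1 ∧ p.1 ^ 2 + p.2 ^ 2 ≤ R ^ 2} =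
          ∅ := by
        refine Set.eq_empty_of_forall_notMem fun y hy => hx ⟨hy.1, ?_⟩
        have h2 : x ^ 2 + y ^ 2 ≤ R ^ 2 := hy.2
        exact abs_le_of_sq_le_sq' (by nlinarith [sq_nonneg y]) hR |>.2
      rw [this, measure_empty]
  simp only [hsec]
  rw [lintegral_indicator measurableSet_Icc, ← ofReal_integral_eq_lintegral_ofReal,
    integral_Icc_eq_integral_Ioc, ← intervalIntegral.integral_of_le hle,
    integral_two_mul_sqrt_sq_sub_sq hR h0 hθ]
  · exact (Continuous.continuousOn (by fun_prop)).integrableOn_Icc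
  · exact ae_of_all _ fun x => by positivity

/-- Cartesian coordinates on the plane. -/
noncomputable def planeEquivProd : Plane ≃ᵐ ℝ × ℝ :=
  (MeasurableEquiv.toLp 2 (Fin 2 → ℝ)).symm.trans MeasurableEquiv.finTwoArrow

lemma planeEquivProd_apply (x : Plane) : planeEquivProd x = (x 0, x 1) := rfl

lemma planeEquivProd_symm_apply (p : ℝ × ℝ) : planeEquivProd.symm p = !₂[p.1, p.2] := by
  rw [MeasurableEquiv.symm_apply_eq, planeEquivProd_apply]
  simp

lemma measurePreserving_planeEquivProd : MeasurePreserving planeEquivProd volume volume :=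
  (volume_preserving_finTwoArrow ℝ).comp
    (EuclideanSpace.volume_preserving_symm_measurableEquiv_toLp (Fin 2))

lemma Plane.dist_le_dist_iff (x z u : Plane) : dist z u ≤ dist x u ↔
    (z 0 - u 0) ^ 2 + (z 1 - u 1) ^ 2 ≤ (x 0 - u 0) ^ 2 + (x 1 - u 1) ^ 2 := by
  rw [EuclideanSpace.dist_eq, EuclideanSpace.dist_eq, Real.sqrt_le_sqrt_iff (by positivity)]
  simp [Fin.sum_univ_two, Real.dist_eq, sq_abs]

lemma wDist_sq (r l φ : ℝ) :
    wDist r l φ ^ 2 = (r * Real.cos φ - l) ^ 2 + (r * Real.sin φ) ^ 2 := by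
  have h : r ^ 2 + l ^ 2 - 2 * r * l * Real.cos φ =
      (r * Real.cos φ - l) ^ 2 + (r * Real.sin φ) ^ 2 := by
    nlinarith [Real.sin_sq_add_cos_sq φ]
  rw [wDist, h, Real.sq_sqrt (by positivity)]

/-- The area of the union of two discs, as the sum of two circular caps: the common chord through
the intersection points of the two circles separates the part of the union belonging to the first
disc from the part belonging to the second. -/
lemma volume_discUnion_eq_eta {r l φ : ℝ} (hr : 0 < r) (hl : 0 ≤ l) (hφ0 : 0 < φ)
    (hφ : φ < Real.pi) {x : Plane} (hx0 : x 0 = r * Real.cos φ)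
    (hx1 : x 1 ^ 2 = (r * Real.sin φ) ^ 2) :
    volume (discUnion 0 !₂[l, 0] x 0) = ENNReal.ofReal (eta r l φ) := by
  have hsin : 0 < Real.sin φ := Real.sin_pos_of_pos_of_lt_pi hφ0 hφ
  have hrs : 0 < r * Real.sin φ := mul_pos hr hsin
  have hw2 := wDist_sq r l φ
  set w := wDist r l φ with hw
  -- `w ≠ 0`, so that no division by zero occurs in the `arccos` term
  have hw0 : 0 < w := by
    rcases (show 0 ≤ w from Real.sqrt_nonneg _).lt_or_eq with h | h
    · exact h
    · rw [← h] at hw2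
      nlinarith
  set θ := Real.arccos ((r * Real.cos φ - l) / w) with hθ
  have habs : |r * Real.cos φ - l| ≤ w := abs_le_of_sq_le_sq (by nlinarith) hw0.le
  have hcos : w * Real.cos θ = r * Real.cos φ - l := by
    rw [hθ, Real.cos_arccos]
    · field_simp
    · rw [le_div_iff₀ hw0]
      linarith [(abs_le.1 habs).1]
    · rw [div_le_one hw0]
      exact (abs_le.1 habs).2
  have hsinθ : w * Real.sin θ = r * Real.sin φ := by
    have h0 : 0 ≤ w * Real.sin θ := mul_nonneg hw0.le
      (Real.sin_nonneg_of_nonneg_of_le_pi (Real.arccos_nonneg _) (Real.arccos_le_pi _))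
    refine (sq_eq_sq₀ h0 hrs.le).1 ?_
    have : (w * Real.sin θ) ^ 2 + (w * Real.cos θ) ^ 2 = w ^ 2 := by
      rw [mul_pow, mul_pow, ← mul_add, Real.sin_sq_add_cos_sq, mul_one]
    rw [hcos] at this
    linarith
  have hrr : (r * Real.cos φ) ^ 2 + (r * Real.sin φ) ^ 2 = r ^ 2 := by
    rw [mul_pow, mul_pow, ← mul_add, Real.cos_sq_add_sin_sq, mul_one]
  set A : Set (ℝ × ℝ) := {p | p.1 ≤ r * Real.cos φ ∧ p.1 ^ 2 + p.2 ^ 2 ≤ r ^ 2} with hA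
  set B : Set (ℝ × ℝ) := {p | r * Real.cos φ ≤ p.1 ∧ (p.1 - l) ^ 2 + p.2 ^ 2 ≤ w ^ 2} with hB
  have hAm : MeasurableSet A := by
    rw [hA, Set.ofPred_and]
    exact (measurableSet_le (by fun_prop) (by fun_prop)).inter
      (measurableSet_le (by fun_prop) (by fun_prop))
  have hBm : MeasurableSet B := by
    rw [hB, Set.ofPred_and]
    exact (measurableSet_le (by fun_prop) (by fun_prop)).inter
      (measurableSet_le (by fun_prop) (by fun_prop))
  have hpre : discUnion 0 !₂[l, 0] x 0 = planeEquivProd ⁻¹' (A ∪ B) := by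
    ext z
    simp only [discUnion, Set.mem_union, Metric.mem_closedBall, add_zero, Set.mem_preimage,
      planeEquivProd_apply, hA, hB, Set.mem_ofPred_eq, Plane.dist_le_dist_iff, hx0]
    simp only [PiLp.zero_apply, sub_zero, Matrix.cons_val_zero,
      Matrix.cons_val_one, hx1, hrr, ← hw2]
    constructor
    · rcases le_total (z 0) (r * Real.cos φ) with h | h
      · rintro (h1 | h1)
        · exact Or.inl ⟨h, h1⟩
        · exact Or.inl ⟨h, by nlinarith⟩
      · rintro (h1 | h1)
        · exact Or.inr ⟨h, by nlinarith⟩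
        · exact Or.inr ⟨h, h1⟩
    · rintro (h | h)
      · exact Or.inl h.2
      · exact Or.inr h.2
  have hAB : AEDisjoint volume A B := by
    refine measure_mono_null (t := ({r * Real.cos φ} : Set ℝ) ×ˢ (Set.univ : Set ℝ)) ?_ ?_
    · rintro p ⟨h1, h2⟩
      exact ⟨le_antisymm h1.1 h2.1, Set.mem_univ _⟩
    · rw [Measure.volume_eq_prod, Measure.prod_prod]
      simp
  have hvA : volume A = ENNReal.ofReal
      (r ^ 2 * ((Real.pi - φ) + Real.cos φ * Real.sin φ)) := by
    have h := volume_circular_cap hr.le (θ := Real.pi - φ) (by linarith) (by linarith)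
    rw [Real.cos_pi_sub, Real.sin_pi_sub] at h
    have hmp : MeasurePreserving (Prod.map (fun t : ℝ => -t) (id : ℝ → ℝ))
        (volume : Measure (ℝ × ℝ)) volume :=
      (Measure.measurePreserving_neg (volume : Measure ℝ)).prod (MeasurePreserving.id _)
    rw [← hmp.measure_preimage hAm.nullMeasurableSet]
    convert h using 2
    · ext p
      simp only [hA, Set.mem_preimage, Prod.map_fst, Prod.map_snd, id, Set.mem_ofPred_eq, neg_sq]
      refine and_congr_left fun _ => ?_
      constructor <;> intro h <;> linarith
    · ring
  have hvB : volume B = ENNReal.ofReal (w ^ 2 * (θ - Real.cos θ * Real.sin θ)) := by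
    rw [← volume_circular_cap hw0.le (Real.arccos_nonneg _) (Real.arccos_le_pi _)]
    have hmp : MeasurePreserving (Prod.map (fun t : ℝ => t + l) (id : ℝ → ℝ))
        (volume : Measure (ℝ × ℝ)) volume :=
      (measurePreserving_add_right (volume : Measure ℝ) l).prod (MeasurePreserving.id _)
    rw [← hmp.measure_preimage hBm.nullMeasurableSet]
    congr 1
    ext p
    simp only [hB, Set.mem_preimage, Prod.map_fst, Prod.map_snd, id, Set.mem_ofPred_eq,
      add_sub_cancel_right]
    refine and_congr_left fun _ => ?_
    rw [hcos, sub_le_iff_le_add]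
  have hcapB : 0 ≤ w ^ 2 * (θ - Real.cos θ * Real.sin θ) := by
    refine mul_nonneg (sq_nonneg _) (sub_nonneg.2 ?_)
    have h1 := Real.sin_le (mul_nonneg zero_le_two (Real.arccos_nonneg _) : 0 ≤ 2 * θ)
    rw [Real.sin_two_mul] at h1
    linarith
  have hcapA : 0 ≤ r ^ 2 * ((Real.pi - φ) + Real.cos φ * Real.sin φ) := by
    refine mul_nonneg (sq_nonneg _) ?_
    have h1 := Real.sin_le (by linarith : 0 ≤ 2 * (Real.pi - φ))
    rw [Real.sin_two_mul, Real.sin_pi_sub, Real.cos_pi_sub] at h1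
    linarith
  rw [hpre, measurePreserving_planeEquivProd.measure_preimage
    (hAm.union hBm).nullMeasurableSet, measure_union₀ hBm.nullMeasurableSet hAB, hvA, hvB,
    ← ENNReal.ofReal_add hcapA hcapB, eta, ← hw, ← hθ]
  congr 1
  have : w ^ 2 * (Real.cos θ * Real.sin θ) = (r * Real.cos φ - l) * (r * Real.sin φ) := by
    rw [← hcos, ← hsinθ]
    ring
  linear_combination -this

/-! ### The probability of a common nearest point -/

lemma eta_nonneg {r l φ : ℝ} (hr : 0 ≤ r) (hl : 0 ≤ l) (h0 : 0 ≤ φ) (hφ : φ ≤ Real.pi) :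
    0 ≤ eta r l φ := by
  have h1 : 0 ≤ Real.pi - φ := sub_nonneg.2 hφ
  have h2 : 0 ≤ Real.sin φ := Real.sin_nonneg_of_nonneg_of_le_pi h0 hφ
  have h3 := Real.arccos_nonneg ((r * Real.cos φ - l) / wDist r l φ)
  unfold eta
  positivity

/-- Every vector of the plane can be rotated onto the nonnegative first coordinate axis. -/
lemma Plane.exists_linearIsometryEquiv_apply_eq (y : Plane) :
    ∃ f : Plane ≃ₗᵢ[ℝ] Plane, f y = !₂[‖y‖, 0] := by
  rcases eq_or_ne y 0 with rfl | hy
  · refine ⟨LinearIsometryEquiv.refl ℝ Plane, ?_⟩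
    ext i
    fin_cases i <;> simp
  · have hn : ‖y‖ ≠ 0 := norm_ne_zero_iff.2 hy
    have ho : Orthonormal ℝ (({0} : Set (Fin 2)).domRestrict fun _ => (‖y‖⁻¹ • y : Plane)) := by
      constructor
      · intro i
        simp [Set.domRestrict, norm_smul, hn]
      · intro i j hij
        exact absurd (Subsingleton.elim i j) hij
    obtain ⟨b, hb⟩ := ho.exists_orthonormalBasis_extension_of_card_eq
      (by simp : Module.finrank ℝ Plane = Fintype.card (Fin 2))
    refine ⟨b.repr, ?_⟩
    have h0 := hb 0 rfl
    have hy0 : y = ‖y‖ • b 0 := by rw [h0, smul_smul, mul_inv_cancel₀ hn, one_smul]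
    have : b.repr y = ‖y‖ • EuclideanSpace.single 0 (1 : ℝ) := by
      conv_lhs => rw [hy0]
      rw [map_smul, OrthonormalBasis.repr_self]
    rw [this]
    ext i
    fin_cases i <;> simp

lemma lintegral_plane_eq_polar (f : Plane → ENNReal) :
    ∫⁻ x, f x = ∫⁻ p in Set.Ioi (0 : ℝ) ×ˢ Set.Ioo (-Real.pi) Real.pi,
      ENNReal.ofReal p.1 * f !₂[p.1 * Real.cos p.2, p.1 * Real.sin p.2] := by
  have h1 := measurePreserving_planeEquivProd.symm.lintegral_comp_emb
    planeEquivProd.symm.measurableEmbedding f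
  rw [← h1, ← lintegral_comp_polarCoord_symm]
  simp [polarCoord_target, planeEquivProd_symm_apply, polarCoord_symm_apply]

lemma lintegral_Ioo_neg_abs (f : ℝ → ENNReal) (a : ℝ) :
    ∫⁻ φ in Set.Ioo (-a) a, f |φ| = 2 * ∫⁻ φ in Set.Ioc 0 a, f φ := by
  rcases le_or_gt a 0 with ha | ha
  · rw [Set.Ioo_eq_empty (by linarith), Set.Ioc_eq_empty (by linarith)]
    simp
  have hpos : ∫⁻ φ in Set.Ioo 0 a, f |φ| = ∫⁻ φ in Set.Ioc 0 a, f φ := by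
    rw [← restrict_Ioo_eq_restrict_Ioc]
    exact setLIntegral_congr_fun measurableSet_Ioo fun φ hφ => by rw [abs_of_pos hφ.1]
  have hneg : ∫⁻ φ in Set.Ioc (-a) 0, f |φ| = ∫⁻ φ in Set.Ioc 0 a, f φ := by
    rw [← restrict_Ioo_eq_restrict_Ioc, ← hpos]
    have h := (Measure.measurePreserving_neg (volume : Measure ℝ)).setLIntegral_comp_preimage_emb
      (MeasurableEquiv.neg ℝ).measurableEmbedding (fun φ => f |φ|) (Set.Ioo 0 a)
    rw [← h]
    simp
  rw [← Set.Ioc_union_Ioo_eq_Ioo (by linarith : -a ≤ 0) ha, lintegral_union measurableSet_Ioo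
    (Set.disjoint_left.2 fun φ h1 h2 => not_lt.2 h1.2 h2.1), hpos, hneg, two_mul]

/-- Integration against the area of the union of the discs around `u` and `u'` through `x`, in
polar coordinates `x - u = (r, φ)` with respect to the direction of `u' - u`. -/
lemma lintegral_volume_discUnion {H : ENNReal → ENNReal} (hH : Measurable H) (u u' : Plane) :
    ∫⁻ x, H (volume (discUnion u u' x 0)) =
      2 * ∫⁻ φ in Set.Ioc 0 Real.pi, ∫⁻ r in Set.Ioi 0,
        ENNReal.ofReal r * H (ENNReal.ofReal (eta r ‖u' - u‖ φ)) := by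
  obtain ⟨f, hf⟩ := Plane.exists_linearIsometryEquiv_apply_eq (u' - u)
  set l := ‖u' - u‖ with hl
  set e : Plane → Plane := fun x => f (x - u) with he
  have hmp : MeasurePreserving e volume volume :=
    f.measurePreserving.comp (measurePreserving_sub_right volume u)
  have hemb : MeasurableEmbedding e :=
    f.toHomeomorph.measurableEmbedding.comp (measurableEmbedding_subRight u)
  have hdist : ∀ x y, dist (e x) (e y) = dist x y := fun x y => by
    simp only [he, f.dist_map, dist_sub_right]
  have heu : e u = 0 := by simp [he]
  have heu' : e u' = !₂[l, 0] := hf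
  have hpre : ∀ x, volume (discUnion u u' x 0) = volume (discUnion 0 !₂[l, 0] (e x) 0) := by
    intro x
    rw [← hmp.measure_preimage (measurableSet_discUnion 0 !₂[l, 0] (e x) 0).nullMeasurableSet]
    congr 1
    ext z
    simp only [discUnion, Set.mem_union, Metric.mem_closedBall, Set.mem_preimage, ← heu, ← heu',
      hdist]
  simp only [hpre]
  rw [hmp.lintegral_comp_emb hemb fun x => H (volume (discUnion 0 !₂[l, 0] x 0)),
    lintegral_plane_eq_polar]
  have hpol : ∀ p ∈ Set.Ioi (0 : ℝ) ×ˢ Set.Ioo (-Real.pi) Real.pi, p.2 ≠ 0 →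
      volume (discUnion 0 !₂[l, 0] !₂[p.1 * Real.cos p.2, p.1 * Real.sin p.2] 0) =
        ENNReal.ofReal (eta p.1 l |p.2|) := by
    rintro ⟨r, φ⟩ ⟨hr, hφ⟩ hne
    refine volume_discUnion_eq_eta hr (norm_nonneg _) (abs_pos.2 hne) (abs_lt.2 hφ) ?_ ?_
    · simp
    · rcases abs_choice φ with h | h <;> simp [h]
  have hae : ∀ᵐ p ∂(volume : Measure (ℝ × ℝ)), p.2 ≠ 0 := by
    have : (volume : Measure (ℝ × ℝ)) ((Set.univ : Set ℝ) ×ˢ ({0} : Set ℝ)) = 0 := by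
      rw [Measure.volume_eq_prod, Measure.prod_prod]
      simp
    filter_upwards [measure_eq_zero_iff_ae_notMem.1 this] with p hp h
    exact hp ⟨Set.mem_univ _, h⟩
  have hmeas : Measurable fun p : ℝ × ℝ =>
      ENNReal.ofReal p.1 * H (ENNReal.ofReal (eta p.1 l |p.2|)) := by
    have h1 : Measurable fun p : ℝ × ℝ => eta p.1 l |p.2| := by
      unfold eta wDist
      fun_prop
    fun_prop
  have hcongr := setLIntegral_congr_fun_ae (measurableSet_Ioi.prod measurableSet_Ioo)
    (hae.mono fun p hp (hpm : p ∈ Set.Ioi (0 : ℝ) ×ˢ Set.Ioo (-Real.pi) Real.pi) =>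
      congrArg (fun t => ENNReal.ofReal p.1 * H t) (hpol p hpm hp))
  refine hcongr.trans ?_
  rw [Measure.volume_eq_prod, ← Measure.prod_restrict, lintegral_prod_symm' _ hmeas]
  exact lintegral_Ioo_neg_abs (fun φ => ∫⁻ r in Set.Ioi 0,
        ENNReal.ofReal r * H (ENNReal.ofReal (eta r l φ))) Real.pi

/-- The probability that two locations at distance `l` have the same nearest point, as a
double integral over the polar coordinates of that point. -/
noncomputable def commonNearestProb (lam l : ℝ) : ENNReal :=
  2 * ∫⁻ φ in Set.Ioc 0 Real.pi, ∫⁻ r in Set.Ioi 0,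
    ENNReal.ofReal (lam * (r * Real.exp (-lam * eta r l φ)))

lemma measure_exists_isNearestBoth_eq {Ω : Type*} [MeasurableSpace Ω] {P : Measure Ω}
    [IsProbabilityMeasure P]
    {lam : ℝ} (hlam : 0 < lam) {X : ℕ → Ω → Plane} (hX : ∀ i, Measurable (X i))
    (hP : IsHomogeneousPoisson (pointProcess X) lam P) (u u' : Plane) :
    P {ω | ∃ i, IsNearestBoth (fun j => X j ω) u u' i} =
      commonNearestProb lam ‖u' - u‖ := by
  rw [measure_exists_isNearestBoth hlam hX hP, commonNearestProb,
    lintegral_volume_discUnion (H := fun t => ENNReal.ofReal (lam *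
      Real.exp (-(lam * t.toReal)))) (by fun_prop)]
  congr 1
  refine setLIntegral_congr_fun measurableSet_Ioc fun φ hφ => ?_
  refine setLIntegral_congr_fun measurableSet_Ioi fun r hr => ?_
  rw [Set.mem_Ioi] at hr
  beta_reduce
  rw [← ENNReal.ofReal_mul hr.le,
    ENNReal.toReal_ofReal (eta_nonneg hr.le (norm_nonneg _) hφ.1.le hφ.2)]
  congr 1
  rw [neg_mul]
  ring

lemma volume_discUnion_self (u x : Plane) :
    (volume (discUnion u u x 0)).toReal = Real.pi * ‖x - u‖ ^ 2 := by
  rw [discUnion, Set.union_self, add_zero, EuclideanSpace.volume_closedBall_fin_two]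
  simp [dist_eq_norm, mul_comm, Real.pi_nonneg]

/-- A fixed location almost surely has a nearest point: the total mass of the density is a Gaussian
integral equal to `1`. -/
lemma measure_exists_isNearestBoth_self {Ω : Type*} [MeasurableSpace Ω] {P : Measure Ω}
    [IsProbabilityMeasure P]
    {lam : ℝ} (hlam : 0 < lam) {X : ℕ → Ω → Plane} (hX : ∀ i, Measurable (X i))
    (hP : IsHomogeneousPoisson (pointProcess X) lam P) (u : Plane) :
    P {ω | ∃ i, IsNearestBoth (fun j => X j ω) u u i} = 1 := by
  rw [measure_exists_isNearestBoth hlam hX hP]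
  simp only [volume_discUnion_self]
  have hpi := Real.pi_pos
  have hb : 0 < lam * Real.pi := by positivity
  have hint := GaussianFourier.integral_rexp_neg_mul_sq_norm (V := Plane) hb
  rw [lintegral_sub_right_eq_self
    (fun x : Plane => ENNReal.ofReal (lam * Real.exp (-(lam * (Real.pi * ‖x‖ ^ 2))))) u]
  have hrw : ∀ x : Plane, lam * Real.exp (-(lam * (Real.pi * ‖x‖ ^ 2))) =
      lam * Real.exp (-(lam * Real.pi) * ‖x‖ ^ 2) := fun x => by
    congr 2
    ring
  have hne : ∫ x : Plane, Real.exp (-(lam * Real.pi) * ‖x‖ ^ 2) ≠ 0 := by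
    rw [hint]
    positivity
  simp only [hrw]
  rw [← ofReal_integral_eq_lintegral_ofReal
    ((Integrable.of_integral_ne_zero hne).const_mul lam)
    (ae_of_all _ fun x => by positivity), integral_const_mul, hint]
  simp only [finrank_euclideanSpace, Fintype.card_fin, Nat.cast_ofNat, div_self (two_ne_zero' ℝ),
    Real.rpow_one]
  rw [show lam * (Real.pi / (lam * Real.pi)) = 1 by field_simp, ENNReal.ofReal_one]

/-! ### Random locations independent of the process -/

/-- The pairs of a point measure and two locations with a common nearest point, described by
countably many rectangles: one ball holds a single point, and a ball around each location, large
enough to contain a disc through every point of the first ball, holds no further one. The centres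
run through a dense sequence and the radii through the rationals. -/
def commonNearestSet : Set (Measure Plane × Plane × Plane) :=
  let d := TopologicalSpace.denseSeq Plane
  ⋃ k : ℕ × ℕ × ℕ × ℚ × ℚ × ℚ, match k with
    | (q, a, a', ρ, α, α') =>
      {μ | μ (Metric.ball (d q) ρ) = 1 ∧ μ (Metric.ball (d a) α) = 1 ∧
        μ (Metric.ball (d a') α') = 1} ×ˢ
      {p | dist (d a) p.1 + dist (d q) p.1 + ρ < α ∧ dist (d a') p.2 + dist (d q) p.2 + ρ < α'}

lemma measurableSet_commonNearestSet : MeasurableSet commonNearestSet := by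
  refine MeasurableSet.iUnion ?_
  rintro ⟨q, a, a', ρ, α, α'⟩
  have h1 : ∀ (v : Plane) (r : ℝ), MeasurableSet {μ : Measure Plane | μ (Metric.ball v r) = 1} :=
    fun v r => Measure.measurable_coe Metric.isOpen_ball.measurableSet (measurableSet_singleton _)
  refine MeasurableSet.prod ((h1 _ _).inter ((h1 _ _).inter (h1 _ _))) ?_
  rw [Set.ofPred_and]
  exact (measurableSet_lt (by fun_prop) (by fun_prop)).inter
    (measurableSet_lt (by fun_prop) (by fun_prop))

/-- In a locally finite configuration the nearest point is nearest by a positive margin. -/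
lemma IsNearestBS.exists_gap {x : ℕ → Plane} {u : Plane} {i : ℕ} (hi : IsNearestBS x u i)
    (hfin : {j | x j ∈ Metric.closedBall u (dist (x i) u + 1)}.Finite) :
    ∀ᶠ δ in 𝓝[>] (0 : ℝ), ∀ j, j ≠ i → dist (x i) u + δ ≤ dist (x j) u := by
  have h1 : ∀ᶠ δ in 𝓝[>] (0 : ℝ), ∀ j ∈ {j | x j ∈ Metric.closedBall u (dist (x i) u + 1)},
      j ≠ i → dist (x i) u + δ ≤ dist (x j) u := by
    rw [eventually_all_finite hfin]
    intro j _
    by_cases hj : j = i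
    · exact Eventually.of_forall fun _ h => absurd hj h
    · have hlt := hi j hj
      rw [← dist_eq_norm, ← dist_eq_norm] at hlt
      filter_upwards [Ioo_mem_nhdsGT (sub_pos.2 hlt)] with δ hδ _
      linarith [hδ.2]
  filter_upwards [h1, Ioo_mem_nhdsGT one_pos] with δ h hδ j hj
  by_cases hmem : x j ∈ Metric.closedBall u (dist (x i) u + 1)
  · exact h j hmem hj
  · rw [Metric.mem_closedBall, not_le] at hmem
    linarith [hδ.2]

/-- Local finiteness of the configuration is what makes room for the rational balls. -/
lemma mem_commonNearestSet_iff {Ω : Type*} {X : ℕ → Ω → Plane} {ω : Ω}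
    (hfin : ∀ (v : Plane) (r : ℝ), {i | X i ω ∈ Metric.closedBall v r}.Finite) (u u' : Plane) :
    (pointProcess X ω, u, u') ∈ commonNearestSet ↔
      ∃ i, IsNearestBoth (fun j => X j ω) u u' i := by
  set d := TopologicalSpace.denseSeq Plane with hd
  simp only [commonNearestSet, Set.mem_iUnion, ← hd, Prod.exists, Set.mem_prod, Set.mem_ofPred_eq,
    pointProcess_eq_one_iff X ω Metric.isOpen_ball.measurableSet]
  -- the ball around `a` contains the small ball around `q`
  have hsub : ∀ {a q v z : Plane} {ρ α : ℝ}, dist a v + dist q v + ρ < α →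
      z ∈ Metric.ball q ρ → z ∈ Metric.ball a α := by
    intro a q v z ρ α h hz
    rw [Metric.mem_ball] at hz ⊢
    have h1 := dist_triangle z q a
    have h2 := dist_triangle_right q a v
    linarith
  constructor
  · rintro ⟨q, a, a', ρ, α, α', ⟨⟨i, hi, hij⟩, ⟨k, hk, hkj⟩, ⟨k', hk', hkj'⟩⟩, h, h'⟩
    have hik : i = k := by
      by_contra hne
      exact hkj i hne (hsub h hi)
    have hik' : i = k' := by
      by_contra hne
      exact hkj' i hne (hsub h' hi)
    subst hik hik'
    have key : ∀ {a v z : Plane} {α : ℝ}, dist a v + dist (d q) v + ρ < α →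
        z ∉ Metric.ball a α → ‖X i ω - v‖ < ‖z - v‖ := by
      intro a v z α h hz
      rw [Metric.mem_ball, not_lt] at hz
      rw [Metric.mem_ball] at hi
      rw [← dist_eq_norm, ← dist_eq_norm]
      have h1 := dist_triangle (X i ω) (d q) v
      have h2 := dist_triangle_right z a v
      linarith
    exact ⟨i, fun j hj => key h (hkj j hj), fun j hj => key h' (hkj' j hj)⟩
  · rintro ⟨i, hi, hi'⟩
    obtain ⟨δ, hδ, hδ', hδ0⟩ := ((hi.exists_gap (hfin _ _)).and
      ((hi'.exists_gap (hfin _ _)).and self_mem_nhdsWithin)).exists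
    replace hδ0 : 0 < δ := hδ0
    -- Moving the three centres by `δ / 8` and keeping the small radius below `δ / 4` leaves room
    -- for radii around `dist (X i ω) u + δ / 2` that still exclude every other point.
    have hdense : ∀ v : Plane, ∃ n, dist (d n) v < δ / 8 := fun v => by
      obtain ⟨n, hn⟩ := (TopologicalSpace.denseRange_denseSeq Plane).exists_dist_lt v
        (by positivity : 0 < δ / 8)
      exact ⟨n, by rwa [dist_comm]⟩
    obtain ⟨q, hq⟩ := hdense (X i ω)
    obtain ⟨a, ha⟩ := hdense u
    obtain ⟨a', ha'⟩ := hdense u'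
    obtain ⟨ρ, hρ, hρ'⟩ := exists_rat_btwn (by linarith : δ / 8 < δ / 4)
    obtain ⟨α, hα1, hα2⟩ := exists_rat_btwn
      (by linarith : dist (X i ω) u + δ / 2 < dist (X i ω) u + 3 * δ / 4)
    obtain ⟨α', hα1', hα2'⟩ := exists_rat_btwn
      (by linarith : dist (X i ω) u' + δ / 2 < dist (X i ω) u' + 3 * δ / 4)
    have hc : dist (d a) u + dist (d q) u + ρ < α := by
      have := dist_triangle (d q) (X i ω) u
      linarith
    have hc' : dist (d a') u' + dist (d q) u' + ρ < α' := by
      have := dist_triangle (d q) (X i ω) u'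
      linarith
    have hiq : X i ω ∈ Metric.ball (d q) ρ := by
      rw [Metric.mem_ball, dist_comm]
      linarith
    have hout : ∀ j, j ≠ i → X j ω ∉ Metric.ball (d a) α := fun j hj hmem => by
      rw [Metric.mem_ball] at hmem
      have := dist_triangle (X j ω) (d a) u
      linarith [hδ j hj]
    have hout' : ∀ j, j ≠ i → X j ω ∉ Metric.ball (d a') α' := fun j hj hmem => by
      rw [Metric.mem_ball] at hmem
      have := dist_triangle (X j ω) (d a') u'
      linarith [hδ' j hj]
    exact ⟨q, a, a', ρ, α, α', ⟨⟨i, hiq, fun j hj hmem => hout j hj (hsub hc hmem)⟩,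
      ⟨i, hsub hc hiq, hout⟩, ⟨i, hsub hc' hiq, hout'⟩⟩, hc, hc'⟩

lemma IsHomogeneousPoisson.ae_finite_closedBall {Ω : Type*} [MeasurableSpace Ω] {P : Measure Ω}
    {lam : ℝ} {X : ℕ → Ω → Plane} (hP : IsHomogeneousPoisson (pointProcess X) lam P) :
    ∀ᵐ ω ∂P, ∀ (v : Plane) (r : ℝ), {i | X i ω ∈ Metric.closedBall v r}.Finite := by
  have h : ∀ᵐ ω ∂P, ∀ n : ℕ, pointProcess X ω (Metric.closedBall 0 n) < ⊤ :=
    ae_all_iff.2 fun n => hP.ae_count_lt_top Metric.isClosed_closedBall.measurableSet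
      measure_closedBall_lt_top.ne
  filter_upwards [h] with ω hω v r
  obtain ⟨n, hn⟩ := exists_nat_ge (r + dist v 0)
  have h1 := hω n
  rw [pointProcess_apply_eq_encard X ω Metric.isClosed_closedBall.measurableSet] at h1
  have h2 : {i | X i ω ∈ Metric.closedBall (0 : Plane) n}.Finite := by
    rw [← Set.encard_lt_top_iff]
    simpa using h1
  exact h2.subset fun i hi => Metric.closedBall_subset_closedBall' hn hi

/-- Conditioning on locations that are independent of the process. -/
lemma measure_exists_isNearestBoth_random {Ω : Type*} [MeasurableSpace Ω] {P : Measure Ω}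
    [IsProbabilityMeasure P] {lam : ℝ} {X : ℕ → Ω → Plane} (hX : ∀ i, Measurable (X i))
    (hP : IsHomogeneousPoisson (pointProcess X) lam P) {U U' : Ω → Plane} (hU : Measurable U)
    (hU' : Measurable U') (hind : IndepFun (pointProcess X) (fun ω => (U ω, U' ω)) P) :
    P {ω | ∃ i, IsNearestBoth (fun j => X j ω) (U ω) (U' ω) i} =
      ∫⁻ ω, P {ω' | ∃ i, IsNearestBoth (fun j => X j ω') (U ω) (U' ω) i} ∂P := by
  have hN := measurable_pointProcess hX
  have hUU : Measurable fun ω => (U ω, U' ω) := hU.prodMk hU'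
  have hE := measurableSet_commonNearestSet
  have : IsProbabilityMeasure (P.map (pointProcess X)) :=
    Measure.isProbabilityMeasure_map hN.aemeasurable
  have : IsProbabilityMeasure (P.map fun ω => (U ω, U' ω)) :=
    Measure.isProbabilityMeasure_map hUU.aemeasurable
  calc _ = P {ω | (pointProcess X ω, U ω, U' ω) ∈ commonNearestSet} := by
        refine measure_congr ?_
        filter_upwards [hP.ae_finite_closedBall] with ω hω
        exact propext (mem_commonNearestSet_iff hω _ _).symm
    _ = P.map (fun ω => (pointProcess X ω, U ω, U' ω)) commonNearestSet := by
        rw [Measure.map_apply (hN.prodMk hUU) hE]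
        rfl
    _ = ∫⁻ ω, P {ω' | (pointProcess X ω', U ω, U' ω) ∈ commonNearestSet} ∂P := by
        rw [(indepFun_iff_map_prod_eq_prod_map_map hN.aemeasurable hUU.aemeasurable).1 hind,
          Measure.prod_apply_symm hE, lintegral_map (measurable_measure_prodMk_right hE) hUU]
        refine lintegral_congr fun ω => ?_
        rw [Measure.map_apply hN (measurable_prodMk_right hE)]
        rfl
    _ = _ := by
        refine lintegral_congr fun ω => measure_congr ?_
        filter_upwards [hP.ae_finite_closedBall] with ω' hω
        exact propext (mem_commonNearestSet_iff hω _ _)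

/-! ### Handovers under periodic skipping -/

lemma location_mul (y : ℕ → Plane) {s : ℕ} (hs : 1 ≤ s) (n : ℕ) :
    location y s (n * s) = ∑ k ∈ Finset.range n, y k := by
  simp [location, Nat.mul_div_cancel n hs]

lemma nearestBS_spec {x : ℕ → Plane} {u : Plane} (h : ∃ i, IsNearestBS x u i) :
    IsNearestBS x u (nearestBS x u) := by
  rw [nearestBS, dif_pos h]
  exact h.choose_spec

lemma nearestBS_eq_iff (x : ℕ → Plane) (u : Plane) (i : ℕ) : nearestBS x u = i ↔
    IsNearestBS x u i ∨ (0 = i ∧ ¬ ∃ j, IsNearestBS x u j) := by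
  by_cases h : ∃ j, IsNearestBS x u j
  · have := nearestBS_spec h
    constructor
    · rintro rfl
      exact Or.inl this
    · rintro (h1 | h1)
      · exact this.unique h1
      · exact absurd h h1.2
  · have h1 : ¬ IsNearestBS x u i := fun h2 => h ⟨i, h2⟩
    simp [nearestBS, h, h1]

/-- At a multiple of the period the connection has just been reexamined. -/
lemma isNearestBS_servingBS_mul {x y : ℕ → Plane} {s n : ℕ}
    (h : ∃ i, IsNearestBS x (location y s (n * s)) i) :
    IsNearestBS x (location y s (n * s)) (servingBS x y s (n * s)) := by
  rcases Nat.eq_zero_or_pos (n * s) with h0 | h0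
  · rw [h0] at h ⊢
    exact nearestBS_spec h
  · obtain ⟨t, ht⟩ := Nat.exists_eq_add_of_le' h0
    have hdvd : s ∣ t + 1 := ht ▸ Dvd.intro_left n rfl
    rw [ht] at h ⊢
    rw [servingBS]
    split_ifs with hc
    · exact nearestBS_spec h
    · exact not_not.1 fun hn => hc ⟨hdvd, hn⟩

/-- Within a cycle the serving base station does not change. -/
lemma servingBS_mul_add (x y : ℕ → Plane) {s : ℕ} (n : ℕ) {r : ℕ} (hr : r < s) :
    servingBS x y s (n * s + r) = servingBS x y s (n * s) := by
  induction r with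
  | zero => rfl
  | succ r ih =>
    rw [← ih (by omega), ← add_assoc, servingBS, if_neg]
    rintro ⟨h, -⟩
    rw [add_assoc, Nat.dvd_add_right (Dvd.intro_left n rfl)] at h
    exact absurd (Nat.le_of_dvd (Nat.succ_pos r) h) (by omega)

/-- A handover takes place at the end of a cycle unless the ends of the cycle have a common nearest
base station. -/
lemma handoverAtSucc_iff {x y : ℕ → Plane} {s n t : ℕ} (hs : 1 ≤ s) (ht : t + 1 = (n + 1) * s)
    (h : ∃ i, IsNearestBS x (location y s (n * s)) i) :
    HandoverAtSucc x y s t ↔ ¬ ∃ i, IsNearestBoth x (location y s (n * s))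
      (location y s ((n + 1) * s)) i := by
  have ht' : t = n * s + (s - 1) := by
    rw [Nat.succ_mul] at ht
    omega
  have hserv : servingBS x y s t = servingBS x y s (n * s) := by
    rw [ht', servingBS_mul_add x y n (by omega)]
  have hdvd : s ∣ t + 1 := ht ▸ Dvd.intro_left _ rfl
  have hnear := isNearestBS_servingBS_mul h
  rw [HandoverAtSucc, hserv, ← ht]
  simp only [hdvd, true_and, not_iff_not]
  constructor
  · exact fun h1 => ⟨_, hnear, h1⟩
  · rintro ⟨i, hi, hi'⟩
    rwa [hnear.unique hi]

lemma handoverCount_eq_sum (x y : ℕ → Plane) (s m : ℕ) :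
    (handoverCount x y s 0 m : ℝ) =
      ∑ t ∈ Finset.range m, {t | HandoverAtSucc x y s t}.indicator (fun _ => (1 : ℝ)) t := by
  classical
  rw [handoverCount, Finset.card_filter, ← Finset.range_eq_Ico]
  push_cast
  refine Finset.sum_congr rfl fun t _ => ?_
  simp [Set.indicator]

section Measurability

variable {Ω : Type*} [MeasurableSpace Ω] {X Y : ℕ → Ω → Plane}

lemma measurable_location (hY : ∀ k, Measurable (Y k)) (s t : ℕ) :
    Measurable fun ω => location (fun k => Y k ω) s t := by
  unfold location
  fun_prop

lemma measurable_nearestBS (hX : ∀ i, Measurable (X i)) {U : Ω → Plane} (hU : Measurable U) :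
    Measurable fun ω => nearestBS (fun i => X i ω) (U ω) := by
  refine measurable_to_countable' fun i => ?_
  have h : (fun ω => nearestBS (fun i => X i ω) (U ω)) ⁻¹' {i} =
      {ω | IsNearestBS (fun j => X j ω) (U ω) i} ∪
        ({_ω : Ω | 0 = i} ∩ (⋃ j, {ω | IsNearestBS (fun j => X j ω) (U ω) j})ᶜ) := by
    ext ω
    simp [nearestBS_eq_iff]
  rw [h]
  exact (measurableSet_isNearestBS hX hU i).union ((MeasurableSet.const _).inter
    (MeasurableSet.iUnion fun j => measurableSet_isNearestBS hX hU j).compl)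

lemma measurableSet_isNearestBS_random (hX : ∀ i, Measurable (X i)) {U : Ω → Plane}
    (hU : Measurable U) {J : Ω → ℕ} (hJ : Measurable J) :
    MeasurableSet {ω | IsNearestBS (fun i => X i ω) (U ω) (J ω)} := by
  have h : {ω | IsNearestBS (fun i => X i ω) (U ω) (J ω)} =
      ⋃ i, J ⁻¹' {i} ∩ {ω | IsNearestBS (fun j => X j ω) (U ω) i} := by
    ext ω
    simp
  rw [h]
  exact MeasurableSet.iUnion fun i =>
    (hJ (measurableSet_singleton i)).inter (measurableSet_isNearestBS hX hU i)

lemma measurable_servingBS (hX : ∀ i, Measurable (X i)) (hY : ∀ k, Measurable (Y k)) (s t : ℕ) :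
    Measurable fun ω => servingBS (fun i => X i ω) (fun k => Y k ω) s t := by
  induction t with
  | zero => exact measurable_nearestBS hX (measurable_location hY s 0)
  | succ t ih =>
    have hloc := measurable_location hY s (t + 1)
    exact Measurable.ite ((MeasurableSet.const _).inter
      (measurableSet_isNearestBS_random hX hloc ih).compl) (measurable_nearestBS hX hloc) ih

lemma measurableSet_handoverAtSucc (hX : ∀ i, Measurable (X i)) (hY : ∀ k, Measurable (Y k))
    (s t : ℕ) :
    MeasurableSet {ω | HandoverAtSucc (fun i => X i ω) (fun k => Y k ω) s t} :=
  (MeasurableSet.const _).inter (measurableSet_isNearestBS_random hX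
    (measurable_location hY s (t + 1)) (measurable_servingBS hX hY s t)).compl

lemma integrable_indicator_handoverAtSucc (P : Measure Ω) [IsFiniteMeasure P]
    (hX : ∀ i, Measurable (X i)) (hY : ∀ k, Measurable (Y k)) (s t : ℕ) :
    Integrable ({ω | HandoverAtSucc (fun i => X i ω) (fun k => Y k ω) s t}.indicator
      fun _ => (1 : ℝ)) P :=
  (integrable_const 1).indicator (measurableSet_handoverAtSucc hX hY s t)

lemma integrable_handoverCount (P : Measure Ω) [IsFiniteMeasure P]
    (hX : ∀ i, Measurable (X i)) (hY : ∀ k, Measurable (Y k)) (s m : ℕ) :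
    Integrable (fun ω => (handoverCount (fun i => X i ω) (fun k => Y k ω) s 0 m : ℝ)) P := by
  simp only [handoverCount_eq_sum]
  exact integrable_finsetSum _ fun t _ => integrable_indicator_handoverAtSucc P hX hY s t

lemma integral_handoverCount (P : Measure Ω) [IsFiniteMeasure P]
    (hX : ∀ i, Measurable (X i)) (hY : ∀ k, Measurable (Y k)) (s m : ℕ) :
    ∫ ω, (handoverCount (fun i => X i ω) (fun k => Y k ω) s 0 m : ℝ) ∂P =
      ∑ t ∈ Finset.range m,
        P.real {ω | HandoverAtSucc (fun i => X i ω) (fun k => Y k ω) s t} := by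
  simp only [handoverCount_eq_sum]
  refine (integral_finsetSum _ fun t _ =>
    integrable_indicator_handoverAtSucc P hX hY s t).trans ?_
  refine Finset.sum_congr rfl fun t _ => ?_
  exact integral_indicator_one (measurableSet_handoverAtSucc hX hY s t)

end Measurability

lemma measurable_commonNearestProb (lam : ℝ) : Measurable (commonNearestProb lam) := by
  unfold commonNearestProb eta wDist
  refine Measurable.const_mul (Measurable.lintegral_prod_right' (f := fun p : ℝ × ℝ => _)
    (Measurable.lintegral_prod_right' (f := fun q : (ℝ × ℝ) × ℝ => ENNReal.ofReal
      (lam * (q.2 * Real.exp (-lam * eta q.2 q.1.1 q.1.2)))) ?_)) 2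
  unfold eta wDist
  fun_prop

/-- The probability of a handover at the end of a cycle is the same for all cycles, because the
displacements are identically distributed. -/
lemma measureReal_handoverAtSucc {Ω : Type*} [MeasurableSpace Ω] {P : Measure Ω}
    [IsProbabilityMeasure P] {lam : ℝ} (hlam : 0 < lam) {s : ℕ} (hs : 1 ≤ s)
    {X : ℕ → Ω → Plane} (hX : ∀ i, Measurable (X i))
    (hPoisson : IsHomogeneousPoisson (pointProcess X) lam P)
    {Y : ℕ → Ω → Plane} (hY : ∀ k, Measurable (Y k)) (hYident : ∀ k, IdentDistrib (Y k) (Y 0) P P)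
    (hXY : IndepFun (pointProcess X) (fun ω k => Y k ω) P) {n t : ℕ} (ht : t + 1 = (n + 1) * s) :
    ∫⁻ ω, commonNearestProb lam ‖Y 0 ω‖ ∂P ≤ 1 ∧
    P.real {ω | HandoverAtSucc (fun i => X i ω) (fun k => Y k ω) s t} =
      1 - (∫⁻ ω, commonNearestProb lam ‖Y 0 ω‖ ∂P).toReal := by
  set U : Ω → Plane := fun ω => location (fun k => Y k ω) s (n * s) with hUdef
  set U' : Ω → Plane := fun ω => location (fun k => Y k ω) s ((n + 1) * s) with hU'def
  have hU : Measurable U := measurable_location hY s _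
  have hU' : Measurable U' := measurable_location hY s _
  have hloc : ∀ t, Measurable fun y : ℕ → Plane => location y s t := fun t => by
    unfold location
    fun_prop
  have hind : IndepFun (pointProcess X) (fun ω => (U ω, U' ω)) P :=
    hXY.comp measurable_id ((hloc (n * s)).prodMk (hloc ((n + 1) * s)))
  have hind' : IndepFun (pointProcess X) (fun ω => (U ω, U ω)) P :=
    hXY.comp measurable_id ((hloc (n * s)).prodMk (hloc (n * s)))
  have hex : ∀ᵐ ω ∂P, ∃ i, IsNearestBS (fun j => X j ω) (U ω) i := by
    have h1 := measure_exists_isNearestBoth_random hX hPoisson hU hU hind'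
    simp only [measure_exists_isNearestBoth_self hlam hX hPoisson, lintegral_one,
      measure_univ] at h1
    have hm : MeasurableSet {ω | ∃ i, IsNearestBoth (fun j => X j ω) (U ω) (U ω) i} := by
      rw [Set.ofPred_exists]
      exact MeasurableSet.iUnion fun i => measurableSet_isNearestBoth hX hU hU i
    filter_upwards [(prob_compl_eq_zero_iff hm).2 h1] with ω hω
    exact hω.imp fun i hi => hi.1
  have hdiff : ∀ ω, U' ω - U ω = Y n ω := fun ω => by
    simp only [hUdef, hU'def, location_mul _ hs, Finset.sum_range_succ, add_sub_cancel_left]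
  have hcommon : P {ω | ∃ i, IsNearestBoth (fun j => X j ω) (U ω) (U' ω) i} =
      ∫⁻ ω, commonNearestProb lam ‖Y 0 ω‖ ∂P := by
    rw [measure_exists_isNearestBoth_random hX hPoisson hU hU' hind]
    simp only [measure_exists_isNearestBoth_eq hlam hX hPoisson, hdiff]
    exact ((hYident n).comp ((measurable_commonNearestProb lam).comp measurable_norm)).lintegral_eq
  have hm : MeasurableSet {ω | ∃ i, IsNearestBoth (fun j => X j ω) (U ω) (U' ω) i} := by
    rw [Set.ofPred_exists]
    exact MeasurableSet.iUnion fun i => measurableSet_isNearestBoth hX hU hU' i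
  refine ⟨hcommon ▸ prob_le_one, ?_⟩
  rw [← hcommon, ← Measure.real, ← probReal_compl_eq_one_sub hm]
  refine measureReal_congr ?_
  filter_upwards [hex] with ω hω
  exact propext (handoverAtSucc_iff hs ht hω)

lemma sum_range_ite_dvd_succ (s m : ℕ) (c : ℝ) :
    ∑ t ∈ Finset.range m, (if s ∣ t + 1 then c else 0) = ((m / s : ℕ) : ℝ) * c := by
  rw [← Finset.sum_filter, Finset.sum_const, nsmul_eq_mul, Nat.card_multiples]

lemma tendsto_natCast_div_div_natCast {s : ℕ} :
    Tendsto (fun m : ℕ => ((m / s : ℕ) : ℝ) / (m : ℝ)) atTop (𝓝 (1 / (s : ℝ))) := by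
  have h := (tendsto_nat_floor_mul_div_atTop (R := ℝ) (a := 1 / (s : ℝ)) (by positivity)).comp
    tendsto_natCast_atTop_atTop
  refine h.congr fun m => ?_
  simp only [Function.comp_apply]
  rw [one_div_mul_eq_div, Nat.floor_div_eq_div]

/-! ### The handover rate -/

/-- The iterated lower integral defining the probability of a common nearest point, rewritten as a
Bochner triple integral; its finiteness makes the integrand integrable. -/
lemma integrable_and_integral_of_lintegral_commonNearestProb {lam : ℝ} (hlam : 0 < lam)
    {F : Measure ℝ} [IsFiniteMeasure F] {c : ℝ}
    (hfin : ∫⁻ v, commonNearestProb lam (c * v) ∂F ≠ ⊤) :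
    Integrable (fun q : ℝ × ℝ × ℝ => q.2.2 * Real.exp (-lam * eta q.2.2 (c * q.1) q.2.1))
      (F.prod ((volume.restrict (Set.Ioc 0 Real.pi)).prod (volume.restrict (Set.Ioi 0)))) ∧
    2 * lam * ∫ v, (∫ φ in (0 : ℝ)..Real.pi, ∫ r in Set.Ioi (0 : ℝ),
        r * Real.exp (-lam * eta r (c * v) φ)) ∂F =
      (∫⁻ v, commonNearestProb lam (c * v) ∂F).toReal := by
  set f : ℝ × ℝ × ℝ → ℝ := fun q => q.2.2 * Real.exp (-lam * eta q.2.2 (c * q.1) q.2.1) with hf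
  set G := (volume.restrict (Set.Ioc 0 Real.pi)).prod (volume.restrict (Set.Ioi (0 : ℝ))) with hG
  have hfm : Measurable f := by
    unfold f eta wDist
    fun_prop
  have hfm' : Measurable fun q => ENNReal.ofReal (f q) := hfm.ennreal_ofReal
  have hpos : ∀ᵐ q ∂F.prod G, 0 ≤ f q := by
    have h1 : ∀ᵐ r ∂volume.restrict (Set.Ioi (0 : ℝ)), 0 ≤ r :=
      (ae_restrict_mem measurableSet_Ioi).mono fun r hr => le_of_lt hr
    have h2 : ∀ᵐ p ∂G, 0 ≤ p.2 := Measure.quasiMeasurePreserving_snd.ae h1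
    have h3 : ∀ᵐ q ∂F.prod G, 0 ≤ q.2.2 := Measure.quasiMeasurePreserving_snd.ae h2
    filter_upwards [h3] with q hq
    exact mul_nonneg hq (Real.exp_nonneg _)
  have hl : ∫⁻ v, commonNearestProb lam (c * v) ∂F =
      ENNReal.ofReal (2 * lam) * ∫⁻ q, ENNReal.ofReal (f q) ∂F.prod G := by
    rw [lintegral_prod _ hfm'.aemeasurable, ← lintegral_const_mul _ hfm'.lintegral_prod_right']
    refine lintegral_congr fun v => ?_
    have hv : Measurable fun p : ℝ × ℝ => ENNReal.ofReal (f (v, p)) :=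
      hfm'.comp measurable_prodMk_left
    rw [hG, lintegral_prod _ hv.aemeasurable, commonNearestProb, ENNReal.ofReal_mul zero_le_two,
      mul_assoc, ENNReal.ofReal_ofNat, ← lintegral_const_mul _ hv.lintegral_prod_right']
    congr 1
    refine lintegral_congr fun φ => ?_
    have hφ : Measurable fun r => ENNReal.ofReal (f (v, φ, r)) := hv.comp measurable_prodMk_left
    rw [← lintegral_const_mul _ hφ]
    refine lintegral_congr fun r => ?_
    rw [ENNReal.ofReal_mul hlam.le]
  have hc0 : ENNReal.ofReal (2 * lam) ≠ 0 := by simpa using hlam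
  have hffin : ∫⁻ q, ENNReal.ofReal (f q) ∂F.prod G ≠ ⊤ := by
    intro h
    rw [hl, h, ENNReal.mul_top hc0] at hfin
    exact hfin rfl
  have hint : Integrable f (F.prod G) :=
    (lintegral_ofReal_ne_top_iff_integrable hfm.aestronglyMeasurable hpos).1 hffin
  refine ⟨hint, ?_⟩
  have hiter : ∫ v, (∫ φ in (0 : ℝ)..Real.pi, ∫ r in Set.Ioi (0 : ℝ),
        r * Real.exp (-lam * eta r (c * v) φ)) ∂F = ∫ q, f q ∂F.prod G := by
    rw [integral_prod _ hint]
    refine integral_congr_ae ?_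
    filter_upwards [hint.prod_right_ae] with v hv
    rw [hG, integral_prod _ hv, intervalIntegral.integral_of_le Real.pi_pos.le]
  rw [hiter, hl, ENNReal.toReal_mul, ENNReal.toReal_ofReal (by positivity),
    integral_eq_lintegral_of_nonneg_ae hpos hfm.aestronglyMeasurable]

theorem proposition3 {Ω : Type*} [MeasurableSpace Ω] (P : Measure Ω) [IsProbabilityMeasure P]
    (lam : ℝ) (hlam : 0 < lam) (s : ℕ) (hs : 1 ≤ s)
    -- the base stations: a homogeneous Poisson process with points `X i`
    (X : ℕ → Ω → Plane) (hX : ∀ i, Measurable (X i))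
    (hPoisson : IsHomogeneousPoisson (pointProcess X) lam P)
    -- the displacements in the cycles: i.i.d. and independent of the Poisson process
    (Y : ℕ → Ω → Plane) (hY : ∀ k, Measurable (Y k))
    (hYindep : iIndepFun Y P) (hYident : ∀ k, IdentDistrib (Y k) (Y 0) P P)
    (hXY : IndepFun (pointProcess X) (fun ω k => Y k ω) P)
    -- the law of the speed `‖Y 0‖ / s` in a cycle
    (FV : Measure ℝ) (hFV : FV = P.map (fun ω => ‖Y 0 ω‖ / (s : ℝ))) :
    (∀ m : ℕ, Integrable
      (fun ω => (handoverCount (fun i => X i ω) (fun k => Y k ω) s 0 m : ℝ)) P) ∧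
    Integrable
      (fun q : ℝ × ℝ × ℝ => q.2.2 * Real.exp (-lam * eta q.2.2 (s * q.1) q.2.1))
      ((FV.restrict (Set.Ici 0)).prod
        ((volume.restrict (Set.Ioc 0 Real.pi)).prod (volume.restrict (Set.Ioi 0)))) ∧
    Tendsto
      (fun m : ℕ =>
        (∫ ω, (handoverCount (fun i => X i ω) (fun k => Y k ω) s 0 m : ℝ) ∂P) / (m : ℝ))
      atTop
      (𝓝 ((1 / (s : ℝ)) *
        (1 - 2 * lam *
          ∫ v in Set.Ici (0 : ℝ), (∫ φ in (0 : ℝ)..Real.pi, ∫ r in Set.Ioi (0 : ℝ),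
            r * Real.exp (-lam * eta r (s * v) φ)) ∂FV))) := by
  have hs0 : (s : ℝ) ≠ 0 := Nat.cast_ne_zero.2 (by omega)
  have hVm : Measurable fun ω => ‖Y 0 ω‖ / (s : ℝ) := (hY 0).norm.div_const _
  have hFVprob : IsProbabilityMeasure FV :=
    hFV ▸ Measure.isProbabilityMeasure_map hVm.aemeasurable
  have hFVpos : FV.restrict (Set.Ici 0) = FV := by
    refine Measure.restrict_eq_self_of_ae_mem ?_
    rw [hFV]
    exact (ae_map_iff hVm.aemeasurable measurableSet_Ici).2
      (ae_of_all _ fun ω => div_nonneg (norm_nonneg _) (Nat.cast_nonneg s))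
  have hprob : ∫⁻ v, commonNearestProb lam (s * v) ∂FV =
      ∫⁻ ω, commonNearestProb lam ‖Y 0 ω‖ ∂P := by
    have hm : Measurable fun v : ℝ => commonNearestProb lam (s * v) :=
      (measurable_commonNearestProb lam).comp (measurable_const_mul (s : ℝ))
    rw [hFV, lintegral_map hm hVm]
    simp only [mul_div_cancel₀ _ hs0]
  have hhand := fun n t (ht : t + 1 = (n + 1) * s) =>
    measureReal_handoverAtSucc hlam hs hX hPoisson hY hYident hXY ht
  have hle := (hhand 0 (s - 1) (by omega)).1
  obtain ⟨hint, hval⟩ := integrable_and_integral_of_lintegral_commonNearestProb (F := FV)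
    (c := s) hlam (hprob ▸ (hle.trans_lt ENNReal.one_lt_top).ne)
  refine ⟨integrable_handoverCount P hX hY s, by rwa [hFVpos], ?_⟩
  rw [hFVpos, hval, hprob]
  set κ := (∫⁻ ω, commonNearestProb lam ‖Y 0 ω‖ ∂P).toReal
  have hsum : ∀ m : ℕ, ∫ ω, (handoverCount (fun i => X i ω) (fun k => Y k ω) s 0 m : ℝ) ∂P =
      ((m / s : ℕ) : ℝ) * (1 - κ) := by
    intro m
    rw [integral_handoverCount P hX hY, ← sum_range_ite_dvd_succ]
    refine Finset.sum_congr rfl fun t _ => ?_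
    split_ifs with hdvd
    · obtain ⟨k, hk⟩ := hdvd
      obtain ⟨n, rfl⟩ : ∃ n, k = n + 1 := Nat.exists_eq_succ_of_ne_zero (by
        rintro rfl
        simp at hk)
      exact (hhand n t (by rw [hk, mul_comm])).2
    · have : {ω | HandoverAtSucc (fun i => X i ω) (fun k => Y k ω) s t} = ∅ :=
        Set.eq_empty_of_forall_notMem fun ω hω => hdvd hω.1
      rw [this, measureReal_empty]
  refine (tendsto_natCast_div_div_natCast.mul_const (1 - κ)).congr fun m => ?_
  rw [hsum]
  ring
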